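/- Let $D\subset\mathbb{R}^2$ be a compact, connected and simply connected set with non-empty interior, bounded by a smooth simple closed curve $\gamma$ of length $L$; let $\gamma(t)$ be an $L$-periodic arc length parameterization, oriented as the boundary of $D$, let $n(t)$ be the inward unit normal, and let $\alpha(t)$ be an angle of the tangent, $\gamma'(t)=(\cos\alpha(t),\sin\alpha(t))$. Let $H$ be a smooth real function on an open neighborhood of $D$, and write $\partial_s^jH(t,0)=\frac{d^j}{ds^j}\big|_{s=0}H(\gamma(t)+s\,n(t))$ for its normal derivatives along $\gamma$. For an integer $n\ge 0$ let $V_n$ be the planar vector field whose components are the real and imaginary parts of $(\partial_x+i\partial_y)^nH$. Suppose that $H$ is constant on $\gamma$, that $\partial_s^jH(t,0)=0$ for all $t$ and all $1\le j\le n-1$, that all zeros of $V_n$ in $D$ are isolated, and that $V_n$ has no zeros on $\gamma$. Then $V_n$ has finitely many zeros in the interior of $D$, and their number, counted with multiplicities, is $n$: the sum over these zeros of the index of $V_n$ (the rotation number of $V_n$ along small counterclockwise circles about the zero) equals $n$. Moreover, along the boundary, in complex notation, $$V_n(\gamma(t))=i^n\,\partial_s^nH(t,0)\,e^{in\alpha(t)},$$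 and the rotation number of $V_n$ along $\gamma$ is $n$. -/

import Mathlib

open scoped ContDiff

/-- The plane is identified with `ℂ` through `(x, y) ↦ x + i y`.  The compact, simply connected
(in particular connected) set `D`, with non-empty interior, is bounded by the smooth simple closed
curve `γ` of length `L`, which is parameterized by arc length and oriented as the boundary of `D`:
the unit normal `i γ'(t)`, obtained from the tangent by a quarter turn counterclockwise, points
into `D`. -/
structure IsBoundedBySmoothCurve (D : Set ℂ) (γ : ℝ → ℂ) (L : ℝ) : Prop where
  isCompact : IsCompact D
  isSimplyConnected : IsSimplyConnected D
  interior_nonempty : (interior D).Nonempty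
  length_pos : 0 < L
  contDiff : ContDiff ℝ ∞ γ
  periodic : Function.Periodic γ L
  norm_deriv : ∀ t : ℝ, ‖deriv γ t‖ = 1
  injOn : Set.InjOn γ (Set.Ico 0 L)
  frontier_eq : frontier D = Set.range γ
  inward : ∀ t : ℝ, ∀ᶠ s : ℝ in nhdsWithin 0 (Set.Ioi 0),
    γ t + (s : ℂ) * (Complex.I * deriv γ t) ∈ interior D

/-- The `j`-th derivative of `H` at the boundary point `γ t` in the direction of the inward unit
normal `i γ'(t)`, i.e. `∂_s^j H(t, 0)` in the coordinates `(t, s) ↦ γ(t) + s i γ'(t)`. -/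
noncomputable def normalDeriv (H : ℂ → ℝ) (γ : ℝ → ℂ) (j : ℕ) (t : ℝ) : ℝ :=
  iteratedDeriv j (fun s : ℝ => H (γ t + (s : ℂ) * (Complex.I * deriv γ t))) 0

/-- The Cauchy-Riemann operator `∂_x + i ∂_y` on complex-valued functions on the plane. -/
noncomputable def cauchyRiemannOp (f : ℂ → ℂ) : ℂ → ℂ :=
  fun z => fderiv ℝ f z 1 + Complex.I * fderiv ℝ f z Complex.I

/-- `V_n = (∂_x + i ∂_y)^n H`; as a vector field on the plane its components are the real and the
imaginary part. -/
noncomputable def loewnerField (H : ℂ → ℝ) (n : ℕ) : ℂ → ℂ :=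
  cauchyRiemannOp^[n] (fun z => (H z : ℂ))

/-- The planar vector `f t` does not vanish for `t ∈ [a, b]`, and a continuous choice of its
argument increases by `2 π m` from `a` to `b`. For a closed curve `f` (`f a = f b`), this says that
`f` has rotation number `m`. -/
def HasRotationNumber (f : ℝ → ℂ) (a b : ℝ) (m : ℤ) : Prop :=
  (∀ t ∈ Set.Icc a b, f t ≠ 0) ∧
    ∃ θ : ℝ → ℝ, ContinuousOn θ (Set.Icc a b) ∧
      (∀ t ∈ Set.Icc a b, f t = (‖f t‖ : ℂ) * Complex.exp ((θ t : ℂ) * Complex.I)) ∧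
      θ b - θ a = 2 * Real.pi * (m : ℝ)

/-- The planar vector field `V` has index (multiplicity) `m` at `z`: its rotation number along every
sufficiently small counterclockwise circle about `z` is `m`. -/
def HasIndexAt (V : ℂ → ℂ) (z : ℂ) (m : ℤ) : Prop :=
  ∀ᶠ r : ℝ in nhdsWithin 0 (Set.Ioi 0),
    HasRotationNumber (fun t : ℝ => V (circleMap z r t)) 0 (2 * Real.pi) m

/-! On the boundary the field is completely explicit. Put N = iγ'. If all derivatives of order k are
constant along γ, differentiating along γ relates (∂_x + i∂_y)^a (∂_x - i∂_y)^b H for the various a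
+ b = k + 1: each equals N^a N̄^b X with one common factor X. Expanding the (k+1)-st normal
derivative in the two operators shows that X is that derivative (`mixedOp_eq_normalDeriv`). While
the normal derivatives vanish, the induction continues, up to order n. Hence V_n = N^n ∂_s^n H on γ.
The real factor has no zero, so V_n rotates n times as often as γ', and γ' rotates once
(`periodicRot_deriv`).

Inside, the Poincaré–Hopf argument `exists_index_sum` equates the boundary rotation number with the
sum of the indices. It divides out one zero z at a time: a zero of index m is replaced by a
zero-free patch, at the cost of a factor (w - z)^m. When no zero is left, simple connectedness of D
makes the rotation number vanish.

Both halves need γ to wind once about interior points. Its winding number is 0 about exterior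
points, jumps by one across γ in a thin tube (`exists_tube`), and is constant along normal segments
from an arbitrary point into the tube. The Umlaufsatz follows by moving one endpoint of a chord of γ
slightly inward, which makes the chord map zero-free on the whole torus.

Rotation numbers are carried throughout by continuous logarithms, the predicate `PeriodicRot`. -/

/-! ### Continuous logarithms and rotation numbers -/

/-- The `L`-periodic function `f : ℝ → ℂ` has a continuous logarithm that increases by `2 π i m`
over each period. -/
def PeriodicRot (f : ℝ → ℂ) (L : ℝ) (m : ℤ) : Prop :=
  ∃ Λ : ℝ → ℂ, Continuous Λ ∧ (∀ t, f t = Complex.exp (Λ t)) ∧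
    ∀ t, Λ (t + L) = Λ t + m * (2 * Real.pi * Complex.I)

/-- A continuous function into `2 π i ℤ` on a preconnected set is constant. -/
theorem eq_of_exp_eq_one {X : Type*} [TopologicalSpace X] {s : Set X} (hs : IsPreconnected s)
    {g : X → ℂ} (hg : ContinuousOn g s) (h : ∀ x ∈ s, Complex.exp (g x) = 1) {x y : X}
    (hx : x ∈ s) (hy : y ∈ s) : g x = g y := by
  have hre : ∀ x ∈ s, ∃ n : ℤ, g x = n * (2 * Real.pi * Complex.I) := fun x hx =>
    Complex.exp_eq_one_iff.1 (h x hx)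
  have key : IsPreconnected ((fun z : ℂ => z.im / (2 * Real.pi)) '' (g '' s)) :=
    (hs.image g hg).image _ (by fun_prop)
  have hsub : (fun z : ℂ => z.im / (2 * Real.pi)) '' (g '' s) ⊆ Set.range ((↑) : ℤ → ℝ) := by
    rintro _ ⟨_, ⟨x, hx, rfl⟩, rfl⟩
    obtain ⟨n, hn⟩ := hre x hx
    refine ⟨n, ?_⟩
    simp only [hn]
    have : (2 * Real.pi) ≠ 0 := by positivity
    rw [show ((n : ℂ) * (2 * Real.pi * Complex.I)).im = n * (2 * Real.pi) by simp]
    field_simp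
  have hcount : (Set.range ((↑) : ℤ → ℝ)).Countable := Set.countable_range _
  have hsubs := (hcount.mono hsub).isTotallyDisconnected _ subset_rfl key
  have hxy := hsubs ⟨_, ⟨x, hx, rfl⟩, rfl⟩ ⟨_, ⟨y, hy, rfl⟩, rfl⟩
  obtain ⟨n, hn⟩ := hre x hx
  obtain ⟨k, hk⟩ := hre y hy
  simp only at hxy
  have hpi : (2 * Real.pi) ≠ 0 := by positivity
  rw [div_left_inj' hpi] at hxy
  rw [hn, hk] at hxy ⊢
  have : ((n : ℝ)) * (2 * Real.pi) = k * (2 * Real.pi) := by simpa using hxy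
  have := mul_right_cancel₀ hpi this
  rw [show (n : ℂ) = k by exact_mod_cast this]

/-- Continuous logarithms exist on simply connected spaces. -/
theorem exists_continuous_log {X : Type*} [TopologicalSpace X] [SimplyConnectedSpace X]
    [LocallyPathConnectedSpace X] {f : X → ℂ} (hf : Continuous f) (h0 : ∀ x, f x ≠ 0) :
    ∃ Λ : X → ℂ, Continuous Λ ∧ ∀ x, f x = Complex.exp (Λ x) := by
  obtain ⟨x0⟩ : Nonempty X := inferInstance
  obtain ⟨F, ⟨-, hF⟩, -⟩ := Complex.isCoveringMapOn_exp.existsUnique_continuousMap_lifts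
    (f := ⟨f, hf⟩) (a₀ := x0) (e₀ := Complex.log (f x0)) (by simp [Complex.exp_log (h0 x0)])
    (fun a => by simpa using h0 a)
  exact ⟨F, F.continuous, fun x => (congrFun hF x).symm⟩

namespace PeriodicRot

variable {f g : ℝ → ℂ} {L : ℝ} {m k : ℤ}

/-- By periodicity of `f` the increment of `Λ` over a period lies in 2πiℤ, and it depends
continuously on the starting point. It is therefore enough to know it at one `a`. -/
theorem of_log_sub {Λ : ℝ → ℂ} (hΛ : Continuous Λ) (h : ∀ t, f t = Complex.exp (Λ t))
    (hp : Function.Periodic f L) {a : ℝ}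
    (ha : Λ (a + L) = Λ a + m * (2 * Real.pi * Complex.I)) : PeriodicRot f L m := by
  refine ⟨Λ, hΛ, h, fun t => ?_⟩
  have := eq_of_exp_eq_one (s := Set.univ) isPreconnected_univ
    (g := fun t => Λ (t + L) - Λ t) (by fun_prop)
    (fun x _ => by
      rw [Complex.exp_sub, ← h, ← h, hp x, div_self]
      rw [h]; exact Complex.exp_ne_zero _) (Set.mem_univ t) (Set.mem_univ a)
  simp only [ha] at this
  linear_combination this

theorem exists_of_continuous (hf : Continuous f) (hp : Function.Periodic f L)
    (h0 : ∀ t, f t ≠ 0) : ∃ m, PeriodicRot f L m := by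
  obtain ⟨Λ, hΛ, h⟩ := exists_continuous_log hf h0
  obtain ⟨m, hm⟩ := (Complex.exp_eq_exp_iff_exists_int (x := Λ (0 + L)) (y := Λ 0)).1 (by
    rw [← h, ← h, hp])
  exact ⟨m, of_log_sub hΛ h hp hm⟩

theorem ne_zero (h : PeriodicRot f L m) (t : ℝ) : f t ≠ 0 := by
  obtain ⟨Λ, -, h, -⟩ := h
  rw [h]; exact Complex.exp_ne_zero _

/-- Two logarithms of the same function differ by a constant on an interval, so a logarithm on a
single period already detects `m`. This is the source of uniqueness. -/
theorem log_sub_eq {Λ : ℝ → ℂ} (h : PeriodicRot f L m) {a : ℝ} (hL : 0 ≤ L)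
    (hΛ : ContinuousOn Λ (Set.Icc a (a + L)))
    (he : ∀ t ∈ Set.Icc a (a + L), f t = Complex.exp (Λ t)) :
    Λ (a + L) = Λ a + m * (2 * Real.pi * Complex.I) := by
  obtain ⟨M, hM, hf, hp⟩ := h
  have := eq_of_exp_eq_one (s := Set.Icc a (a + L)) isPreconnected_Icc
    (g := fun t => Λ t - M t) (by fun_prop)
    (fun x hx => by
      rw [Complex.exp_sub, ← he x hx, ← hf, div_self]
      rw [hf]; exact Complex.exp_ne_zero _)
    (x := a + L) (y := a) ⟨by linarith, le_rfl⟩ ⟨le_rfl, by linarith⟩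
  simp only [hp a] at this
  linear_combination this

theorem int_unique_aux (h : (m : ℂ) * (2 * Real.pi * Complex.I) = k * (2 * Real.pi * Complex.I)) :
    m = k := by
  have := mul_right_cancel₀ Complex.two_pi_I_ne_zero h
  exact_mod_cast this

theorem unique (hL : 0 ≤ L) (h : PeriodicRot f L m) (h' : PeriodicRot f L k) : m = k := by
  obtain ⟨M, hM, hf, hp⟩ := h
  have := h'.log_sub_eq (a := 0) hL hM.continuousOn (fun t _ => hf t)
  rw [hp] at this
  exact int_unique_aux (add_left_cancel this)

theorem mul (hf : PeriodicRot f L m) (hg : PeriodicRot g L k) :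
    PeriodicRot (fun t => f t * g t) L (m + k) := by
  obtain ⟨M, hM, hf, hp⟩ := hf
  obtain ⟨N, hN, hg, hq⟩ := hg
  refine ⟨fun t => M t + N t, by fun_prop, fun t => by simp only [hf, hg, Complex.exp_add], fun t => ?_⟩
  simp only [hp, hq]; push_cast; ring

theorem const (c : ℂ) (hc : c ≠ 0) : PeriodicRot (fun _ => c) L 0 :=
  ⟨fun _ => Complex.log c, continuous_const, fun _ => (Complex.exp_log hc).symm, by simp⟩

theorem zpow (hf : PeriodicRot f L m) (n : ℤ) : PeriodicRot (fun t => f t ^ n) L (n * m) := by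
  obtain ⟨M, hM, hf, hp⟩ := hf
  refine ⟨fun t => n * M t, by fun_prop, fun t => by simp only [hf, Complex.exp_int_mul], fun t => ?_⟩
  simp only [hp]; push_cast; ring

theorem pow (hf : PeriodicRot f L m) (n : ℕ) : PeriodicRot (fun t => f t ^ n) L (n * m) := by
  simpa using hf.zpow n

theorem of_slitPlane (hf : Continuous f) (hp : Function.Periodic f L)
    (h : ∀ t, f t ∈ Complex.slitPlane) : PeriodicRot f L 0 :=
  ⟨fun t => Complex.log (f t), hf.clog h,
    fun t => (Complex.exp_log (Complex.slitPlane_ne_zero (h t))).symm, fun t => by simp [hp t]⟩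

theorem congr (hf : PeriodicRot f L m) (h : ∀ t, g t = f t) : PeriodicRot g L m := by
  rwa [show g = f from funext h]

/-- A Rouché-type comparison: the quotient `f / g` has a periodic logarithm, the principal one, and
contributes no rotation to `f = g * (f / g)`. -/
theorem of_div_slitPlane (hg : PeriodicRot g L m) (hf : Continuous f)
    (hp : Function.Periodic f L) (hgc : Continuous g) (hgp : Function.Periodic g L)
    (h : ∀ t, f t / g t ∈ Complex.slitPlane) : PeriodicRot f L m := by
  have := hg.mul (of_slitPlane (hf.div hgc hg.ne_zero)
    (fun t => by simp only [Pi.div_apply, hp t, hgp t]) h)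
  rw [add_zero] at this
  refine this.congr fun t => ?_
  rw [Pi.div_apply, mul_div_cancel₀ _ (hg.ne_zero t)]

/-- Homotopy invariance of the rotation number. -/
theorem homotopy {X : Type*} [TopologicalSpace X] [PreconnectedSpace X] {F : X → ℝ → ℂ}
    (hL : 0 < L) (hF : Continuous (Function.uncurry F)) (hp : ∀ x, Function.Periodic (F x) L)
    (h0 : ∀ x t, F x t ≠ 0) {x y : X} (h : PeriodicRot (F x) L m) : PeriodicRot (F y) L m := by
  have hc : ∀ x, Continuous (F x) := fun x => hF.comp (Continuous.prodMk_right x)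
  have hex : ∀ x, ∃ m, PeriodicRot (F x) L m := fun x => exists_of_continuous (hc x) (hp x) (h0 x)
  choose r hr using hex
  have hloc : IsLocallyConstant r := by
    rw [IsLocallyConstant.iff_eventually_eq]
    intro x
    have hopen : IsOpen {q : X × ℝ | F q.1 q.2 / F x q.2 ∈ Complex.slitPlane} := by
      refine Complex.isOpen_slitPlane.preimage ?_
      exact hF.div ((hc x).comp continuous_snd) (fun q => h0 x q.2)
    -- The quotient is 1 at `y = x`, and a period is compact, so for nearby `y` it stays in the slit
    -- plane uniformly in `t`. Thus the rotation number is locally constant.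
    have hK : ∀ᶠ y in nhds x, ∀ t ∈ Set.Icc 0 L, F y t / F x t ∈ Complex.slitPlane := by
      refine isCompact_Icc.eventually_forall_of_forall_eventually fun t _ => ?_
      exact hopen.mem_nhds (by simp [div_self (h0 x t)])
    filter_upwards [hK] with y hy
    refine unique hL.le (hr y) ((hr x).of_div_slitPlane (hc y) (hp y) (hc x) (hp x) fun t => ?_)
    have hper : Function.Periodic (fun t => F y t / F x t) L := fun t => by
      simp only [hp y t, hp x t]
    obtain ⟨s, hs, hst⟩ := hper.exists_mem_Ico₀ hL t
    rw [hst]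
    exact hy s (Set.Ico_subset_Icc_self hs)
  have hxy := hloc.apply_eq_of_isPreconnected isPreconnected_univ (Set.mem_univ x) (Set.mem_univ y)
  rw [unique hL.le h (hr x), hxy]
  exact hr y

theorem homotopyOn {X : Type*} [TopologicalSpace X] {S : Set X} (hS : IsPreconnected S)
    {F : X → ℝ → ℂ} (hL : 0 < L) (hF : ContinuousOn (Function.uncurry F) (S ×ˢ Set.univ))
    (hp : ∀ x ∈ S, Function.Periodic (F x) L)
    (h0 : ∀ x ∈ S, ∀ t, F x t ≠ 0) {x y : X} (hx : x ∈ S) (hy : y ∈ S)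
    (h : PeriodicRot (F x) L m) : PeriodicRot (F y) L m := by
  have : PreconnectedSpace S := isPreconnected_iff_preconnectedSpace.1 hS
  refine homotopy (X := S) (F := fun x => F x) (x := ⟨x, hx⟩) (y := ⟨y, hy⟩) hL ?_
    (fun x => hp x x.2) (fun x => h0 x x.2) h
  exact hF.comp_continuous (f := fun q : S × ℝ => ((q.1 : X), q.2)) (by fun_prop)
    (fun q => ⟨q.1.2, Set.mem_univ _⟩)

/-- On a torus the rotation number along the diagonal is the sum of those along the axes. -/
theorem diagonal {F : ℝ → ℝ → ℂ} (hF : Continuous (Function.uncurry F)) (hL : 0 ≤ L)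
    (hp : ∀ s t, F (s + L) t = F s t) (hq : ∀ s t, F s (t + L) = F s t)
    {a b : ℝ} (h1 : PeriodicRot (fun s => F s a) L m) (h2 : PeriodicRot (fun t => F b t) L k)
    (h0 : ∀ s t, F s t ≠ 0) :
    PeriodicRot (fun t => F t t) L (m + k) := by
  obtain ⟨Λ, hΛ, h⟩ := exists_continuous_log hF (fun x => h0 x.1 x.2)
  have e1 := h1.log_sub_eq (a := a) (Λ := fun s => Λ (s, a)) hL (by fun_prop) (fun t _ => h (t, a))
  have e2 := h2.log_sub_eq (a := b) (Λ := fun s => Λ (b, s)) hL (by fun_prop) (fun t _ => h (b, t))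
  -- The increment of `Λ` over one period of the second variable is the same at every point of the
  -- plane, so it may be moved from the line through `a + L` to the one through `b`.
  have e3 : Λ (a + L, a + L) - Λ (a + L, a) = Λ (b, b + L) - Λ (b, b) := by
    refine eq_of_exp_eq_one (s := Set.univ) isPreconnected_univ
      (g := fun x : ℝ × ℝ => Λ (x.1, x.2 + L) - Λ (x.1, x.2)) (by fun_prop)
      (fun x _ => ?_) (x := (a + L, a)) (y := (b, b)) (Set.mem_univ _) (Set.mem_univ _)
    rw [Complex.exp_sub, ← h, ← h]
    simp only [Function.uncurry, hq]
    exact div_self (h0 _ _)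
  refine of_log_sub (Λ := fun t => Λ (t, t)) (by fun_prop) (fun t => h (t, t))
    (fun t => by simp only [hp, hq]) (a := a) ?_
  push_cast
  linear_combination e1 + e2 + e3

theorem hasRotationNumber (h : PeriodicRot f L m) : HasRotationNumber f 0 L m := by
  refine ⟨fun t _ => h.ne_zero t, ?_⟩
  obtain ⟨Λ, hΛ, hf, hp⟩ := h
  refine ⟨fun t => (Λ t).im, by fun_prop, fun t _ => ?_, ?_⟩
  · rw [hf, Complex.norm_exp, Complex.ofReal_exp, ← Complex.exp_add, Complex.re_add_im]
  · have := hp 0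
    rw [zero_add] at this
    simp [this]; ring

end PeriodicRot

/-! ### Indices of isolated zeros -/

/-- The rotation number of `f` along every sufficiently small circle about `z` is `m`. -/
def PeriodicIndexAt (f : ℂ → ℂ) (z : ℂ) (m : ℤ) : Prop :=
  ∀ᶠ r : ℝ in nhdsWithin 0 (Set.Ioi 0),
    PeriodicRot (fun t => f (circleMap z r t)) (2 * Real.pi) m

theorem PeriodicIndexAt.hasIndexAt {f : ℂ → ℂ} {z : ℂ} {m : ℤ} (h : PeriodicIndexAt f z m) :
    HasIndexAt f z m :=
  Filter.Eventually.mono h fun _ hr => hr.hasRotationNumber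

/-- Concentric circles are homotopic in the punctured disc. One integer therefore serves all radii
up to `R`, not only small ones; the surgery in `exists_index_sum` uses the radius `R` itself. -/
theorem exists_periodicRot_circleMap {f : ℂ → ℂ} {z : ℂ} {R : ℝ} (hR : 0 < R)
    (hf : ContinuousOn f (Metric.closedBall z R \ {z}))
    (h0 : ∀ w ∈ Metric.closedBall z R \ {z}, f w ≠ 0) :
    ∃ m : ℤ, ∀ r ∈ Set.Ioc 0 R, PeriodicRot (fun t => f (circleMap z r t)) (2 * Real.pi) m := by
  have hmem : ∀ r ∈ Set.Ioc 0 R, ∀ t, circleMap z r t ∈ Metric.closedBall z R \ {z} := by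
    intro r hr t
    refine ⟨?_, ?_⟩
    · exact Metric.closedBall_subset_closedBall hr.2 (circleMap_mem_closedBall z hr.1.le t)
    · exact circleMap_ne_center (c := z) (θ := t) hr.1.ne'
  have hc : ContinuousOn (Function.uncurry fun r t => f (circleMap z r t))
      (Set.Ioc 0 R ×ˢ Set.univ) := by
    refine hf.comp (t := Metric.closedBall z R \ {z})
      (f := fun q : ℝ × ℝ => circleMap z q.1 q.2) ?_ fun q hq => hmem _ hq.1 _
    simp only [circleMap]
    fun_prop
  have hp : ∀ r, Function.Periodic (fun t => f (circleMap z r t)) (2 * Real.pi) := fun r t => by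
    simp only [periodic_circleMap z r t]
  obtain ⟨m, hm⟩ := PeriodicRot.exists_of_continuous
    (f := fun t => f (circleMap z R t)) (L := 2 * Real.pi)
    (hf.comp_continuous (continuous_circleMap z R) (hmem R ⟨hR, le_rfl⟩)) (hp R)
    (fun t => h0 _ (hmem R ⟨hR, le_rfl⟩ t))
  exact ⟨m, fun r hr => PeriodicRot.homotopyOn isPreconnected_Ioc Real.two_pi_pos hc
    (fun r _ => hp r) (fun r hr t => h0 _ (hmem r hr t)) (x := R) ⟨hR, le_rfl⟩ hr hm⟩

theorem PeriodicIndexAt.congr {f g : ℂ → ℂ} {z : ℂ} {m : ℤ} (h : PeriodicIndexAt f z m)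
    (hfg : ∀ᶠ w in nhds z, f w = g w) : PeriodicIndexAt g z m := by
  obtain ⟨ε, hε, hball⟩ := Metric.eventually_nhds_iff.1 hfg
  filter_upwards [h, Ioo_mem_nhdsGT hε] with r hr hrε
  refine hr.congr fun t => (hball ?_).symm
  simpa [circleMap, abs_of_pos hrε.1] using hrε.2

theorem PeriodicIndexAt.mul {f g : ℂ → ℂ} {z : ℂ} {m k : ℤ} (hf : PeriodicIndexAt f z m)
    (hg : PeriodicIndexAt g z k) : PeriodicIndexAt (fun w => f w * g w) z (m + k) := by
  filter_upwards [hf, hg] with r h1 h2 using h1.mul h2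

theorem periodicRot_circleMap_sub_center (z : ℂ) {r : ℝ} (hr : r ≠ 0) :
    PeriodicRot (fun t => circleMap z r t - z) (2 * Real.pi) 1 := by
  refine ⟨fun t => Complex.log r + t * Complex.I, by fun_prop, fun t => ?_, fun t => ?_⟩
  · simp [circleMap, Complex.exp_add, Complex.exp_log, hr]
  · push_cast; ring

/-- On a circle about `z` of radius less than `‖z - w‖`, the quotient of `x - w` by the constant `z
- w` stays within distance 1 of 1. -/
theorem periodicIndexAt_sub_zpow {z w : ℂ} (h : z ≠ w) (m : ℤ) :
    PeriodicIndexAt (fun x => (x - w) ^ m) z 0 := by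
  have hpos : 0 < ‖z - w‖ := norm_pos_iff.2 (sub_ne_zero.2 h)
  filter_upwards [Ioo_mem_nhdsGT hpos] with r hr
  have key : PeriodicRot (fun t => circleMap z r t - w) (2 * Real.pi) 0 := by
    refine (PeriodicRot.const (z - w) (sub_ne_zero.2 h)).of_div_slitPlane
      (by fun_prop) (fun t => by simp only [periodic_circleMap z r t]) continuous_const
      (fun _ => rfl) fun t => ?_
    have hzw := sub_ne_zero.2 h
    rw [show (circleMap z r t - w) / (z - w) = 1 + (circleMap z r t - z) / (z - w) by
      field_simp; ring]
    refine Complex.mem_slitPlane_of_norm_lt_one ?_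
    rw [norm_div, div_lt_one hpos]
    simpa [circleMap, abs_of_pos hr.1] using hr.2
  simpa using key.zpow m

/-- A zero-free function with rotation number zero on a circle has a logarithm there, and this
logarithm extends continuously to the plane. -/
theorem exists_log_on_sphere {f : ℂ → ℂ} {z : ℂ} {r : ℝ} (hr : 0 < r)
    (h : PeriodicRot (fun t => f (circleMap z r t)) (2 * Real.pi) 0) :
    ∃ l : ℂ → ℂ, Continuous l ∧ ∀ w ∈ Metric.sphere z r, f w = Complex.exp (l w) := by
  obtain ⟨Λ, hΛ, hf, hp⟩ := h
  -- Rotation number zero makes the logarithm itself periodic, so it descends to the circle;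
  -- Tietze's theorem then extends it to the plane.
  have hper : Function.Periodic Λ (2 * Real.pi) := fun t => by simpa using hp t
  have hcirc : Continuous fun c : Circle => Λ (Complex.arg c) := by
    rw [Circle.isAddQuotientCoveringMap_exp.toIsQuotientMap.continuous_iff]
    convert! hΛ using 1
    funext t
    simp only [Function.comp]
    obtain ⟨n, hn⟩ := Circle.exp_eq_exp.1 (Circle.exp_arg (Circle.exp t))
    rw [hn]
    exact hper.int_mul n t
  have hsph : ∀ w : Metric.sphere z r, ((w : ℂ) - z) / r ∈ Submonoid.unitSphere ℂ := by
    intro w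
    have := w.2
    rw [mem_sphere_iff_norm] at this
    have h1 : ‖((w : ℂ) - z) / r‖ = 1 := by simp [this, abs_of_pos hr, hr.ne']
    simpa [Submonoid.unitSphere] using h1
  let c : Metric.sphere z r → Circle := fun w => ⟨((w : ℂ) - z) / r, hsph w⟩
  have hc : Continuous c := by
    refine Continuous.subtype_mk ?_ _
    fun_prop
  obtain ⟨l, hl⟩ := ContinuousMap.exists_restrict_eq (Metric.isClosed_sphere (x := z) (ε := r))
    ⟨fun w => Λ (Complex.arg (c w)), hcirc.comp hc⟩
  refine ⟨l, l.continuous, fun w hw => ?_⟩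
  have h1 : l w = Λ (Complex.arg (c ⟨w, hw⟩)) := congrArg (fun g => g ⟨w, hw⟩) hl
  rw [h1, ← hf]
  congr 1
  have h2 := Circle.coe_exp (Complex.arg (c ⟨w, hw⟩))
  rw [Circle.exp_arg] at h2
  rw [circleMap, ← h2]
  have : (r : ℂ) ≠ 0 := by exact_mod_cast hr.ne'
  simp only [c]
  field_simp
  ring

/-! ### The Poincaré–Hopf argument -/

/-- A loop in a simply connected set has rotation number zero under a zero-free continuous map. -/
theorem periodicRot_comp_zero_of_isSimplyConnected {D : Set ℂ} (hD : IsSimplyConnected D)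
    {γ : ℝ → ℂ} {L : ℝ} (hL : 0 < L) (hγ : Continuous γ) (hp : Function.Periodic γ L)
    (hmem : ∀ t, γ t ∈ D) {W : ℂ → ℂ} (hW : ContinuousOn W D) (h0 : ∀ z ∈ D, W z ≠ 0) :
    PeriodicRot (fun t => W (γ t)) L 0 := by
  let p : Path (γ 0) (γ 0) :=
    { toFun := fun t => γ (L * t)
      continuous_toFun := by fun_prop
      source' := by simp
      target' := by simpa using hp 0 }
  obtain ⟨F, hF⟩ := (isSimplyConnected_iff_exists_homotopy_refl_forall_mem.1 hD).2 _ p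
    fun t => hmem _
  let G : unitInterval → ℝ → ℂ := fun x y => W (F (x, Set.projIcc 0 1 zero_le_one y))
  have hG : Continuous (Function.uncurry G) :=
    hW.comp_continuous (F.continuous.comp (continuous_fst.prodMk
      (continuous_projIcc.comp continuous_snd))) fun q => hF _
  -- The null-homotopy keeps endpoints fixed, so each intermediate path closes up and extends
  -- periodically; the equal endpoint values make the fractional part harmless for continuity.
  let K : unitInterval → ℝ → ℂ := fun x t => G x (Int.fract (t / L))
  have hK : Continuous (Function.uncurry K) := by
    have := ContinuousOn.comp_fract (s := fun q : unitInterval × ℝ => q.2 / L)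
      (f := fun q : unitInterval × ℝ => G q.1)
      (by
        refine Continuous.continuousOn ?_
        exact hG.comp ((continuous_fst.comp continuous_fst).prodMk continuous_snd))
      (by fun_prop) (fun q => by simp [G])
    exact this
  have hpK : ∀ x, Function.Periodic (K x) L := fun x t => by
    simp only [K, add_div, div_self hL.ne', Int.fract_add_one]
  have hK0 : ∀ x t, K x t ≠ 0 := fun x t => h0 _ (hF _)
  have h1 : PeriodicRot (K 1) L 0 :=
    (PeriodicRot.const (W (γ 0)) (h0 _ (hmem 0))).congr fun t => by simp [K, G]
  refine (PeriodicRot.homotopy hL hK hpK hK0 (y := 0) h1).congr fun t => ?_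
  have hfr : Set.projIcc (0 : ℝ) 1 zero_le_one (Int.fract (t / L)) =
      ⟨Int.fract (t / L), Int.fract_nonneg _, (Int.fract_lt_one _).le⟩ :=
    Set.projIcc_of_mem _ _
  simp only [K, G, hfr, ContinuousMap.HomotopyWith.apply_zero, p, ContinuousMap.coe_mk]
  congr 1
  have : L * Int.fract (t / L) = t - ⌊t / L⌋ * L := by
    rw [Int.fract]; field_simp
  simp only [this]
  exact (hp.sub_int_mul_eq _).symm

/-- The Poincaré-Hopf argument: the rotation number along a curve that winds once about each
interior point is the sum of the indices of the enclosed zeros. -/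
theorem exists_index_sum {D : Set ℂ} (hD : IsSimplyConnected D)
    {γ : ℝ → ℂ} {L : ℝ} (hL : 0 < L) (hγ : Continuous γ) (hp : Function.Periodic γ L)
    (hmem : ∀ t, γ t ∈ D) (hint : ∀ t, γ t ∉ interior D)
    (hwind : ∀ z ∈ interior D, PeriodicRot (fun t => γ t - z) L 1) (Z : Finset ℂ) :
    -- The function is quantified after `Z` because the induction step replaces it.
    ∀ f : ℂ → ℂ, (∀ z ∈ Z, z ∈ interior D) → ContinuousOn f D → (∀ z ∈ D, z ∉ Z → f z ≠ 0) →
      ∃ ind : ℂ → ℤ, (∀ z ∈ Z, PeriodicIndexAt f z (ind z)) ∧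
        PeriodicRot (fun t => f (γ t)) L (∑ z ∈ Z, ind z) := by
  classical
  induction Z using Finset.induction_on with
  | empty =>
    intro f _ hf h0
    refine ⟨0, by simp, ?_⟩
    simpa using periodicRot_comp_zero_of_isSimplyConnected hD hL hγ hp hmem hf
      (fun z hz => h0 z hz (by simp))
  | insert z Z hzZ ih =>
    intro f hZ hf h0
    have hzD : z ∈ interior D := hZ z (by simp)
    have hopen : IsOpen (interior D ∩ (Z : Set ℂ)ᶜ) :=
      isOpen_interior.inter Z.finite_toSet.isClosed.isOpen_compl
    obtain ⟨R, hR, hball⟩ := Metric.nhds_basis_closedBall.mem_iff.1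
      (hopen.mem_nhds ⟨hzD, by simpa using hzZ⟩)
    have hballD : Metric.closedBall z R ⊆ D := fun w hw => interior_subset (hball hw).1
    obtain ⟨m, hm⟩ := exists_periodicRot_circleMap hR
      (hf.mono (Set.sdiff_subset.trans hballD)) fun w hw => by
        refine h0 w (hballD hw.1) ?_
        rw [Finset.mem_insert, not_or]
        exact ⟨hw.2, fun h => (hball hw.1).2 h⟩
    have hfz : PeriodicIndexAt f z m := by
      filter_upwards [Ioc_mem_nhdsGT hR] with r hr using hm r hr
    have hrot : PeriodicRot (fun t => (fun w => f w * (w - z) ^ (-m)) (circleMap z R t))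
        (2 * Real.pi) 0 := by
      simpa using (hm R ⟨hR, le_rfl⟩).mul ((periodicRot_circleMap_sub_center z hR.ne').zpow (-m))
    obtain ⟨l, hl, hle⟩ :=
      exists_log_on_sphere (f := fun w => f w * (w - z) ^ (-m)) hR hrot
    -- Surgery at `z`: outside the ball the factor `(w - z) ^ m` is divided out, and inside, the
    -- result is replaced by the exponential of the extended logarithm. The two pieces agree on the
    -- sphere, and `g` has no zero in the ball.
    let g : ℂ → ℂ := fun w =>
      if w ∈ Metric.closedBall z R then Complex.exp (l w) else f w * (w - z) ^ (-m)
    have hgf : ∀ w, w ∉ Metric.closedBall z R → f w = g w * (w - z) ^ m := by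
      intro w hw
      have hwz : w - z ≠ 0 := by
        rw [sub_ne_zero]; rintro rfl; exact hw (Metric.mem_closedBall_self hR.le)
      simp only [g, if_neg hw]
      rw [mul_assoc, ← zpow_add₀ hwz]; simp
    have hgc : ContinuousOn g D := by
      refine ContinuousOn.if ?_ (hl.cexp.continuousOn) ?_
      · rintro w ⟨-, hw⟩
        rw [Set.ofPred_mem_eq, frontier_closedBall _ hR.ne'] at hw
        exact (hle w hw).symm
      · have hcl : closure {w | w ∉ Metric.closedBall z R} ⊆ {z}ᶜ := by
          refine (closure_minimal (t := (Metric.ball z R)ᶜ) ?_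
            Metric.isOpen_ball.isClosed_compl).trans ?_
          · exact fun w hw h => hw (Metric.ball_subset_closedBall h)
          · intro w hw h
            rw [Set.mem_singleton_iff] at h
            exact hw (h ▸ Metric.mem_ball_self hR)
        refine (hf.mono Set.inter_subset_left).mul ?_
        refine ContinuousOn.zpow₀ (by fun_prop) _ fun w hw => Or.inl ?_
        exact sub_ne_zero.2 (hcl hw.2)
    have hg0 : ∀ w ∈ D, w ∉ Z → g w ≠ 0 := by
      intro w hw hwZ
      by_cases hwb : w ∈ Metric.closedBall z R
      · simp only [g, if_pos hwb]; exact Complex.exp_ne_zero _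
      · have hwz : w ≠ z := by rintro rfl; exact hwb (Metric.mem_closedBall_self hR.le)
        intro hg
        refine h0 w hw (by simp [hwz, hwZ]) ?_
        rw [hgf w hwb, hg, zero_mul]
    obtain ⟨ind, hind, hsum⟩ := ih g (fun w hw => hZ w (by simp [hw])) hgc hg0
    refine ⟨fun w => if w = z then m else ind w, ?_, ?_⟩
    · intro w hw
      by_cases hwz : w = z
      · subst hwz; simpa using hfz
      · have hwZ : w ∈ Z := (Finset.mem_insert.1 hw).resolve_left hwz
        simp only [if_neg hwz]
        -- At the other zeros the factor removed has index 0, so `f` and `g` have equal indices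
        -- there.
        have := (hind w hwZ).mul (periodicIndexAt_sub_zpow hwz m)
        rw [add_zero] at this
        refine this.congr ?_
        have : w ∈ (Metric.closedBall z R)ᶜ := fun h => (hball h).2 hwZ
        filter_upwards [Metric.isClosed_closedBall.isOpen_compl.mem_nhds this] with x hx
        exact (hgf x hx).symm
    -- Along `γ` the removed factor contributes exactly `m`, since `γ` winds once about `z`.
    · have h1 := hsum.mul ((hwind z hzD).zpow m)
      have h2 : ∑ w ∈ Z, (if w = z then m else ind w) = ∑ w ∈ Z, ind w :=
        Finset.sum_congr rfl fun w hw => if_neg fun h : w = z => hzZ (h ▸ hw)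
      rw [Finset.sum_insert hzZ, if_pos rfl, h2, add_comm]
      rw [mul_one] at h1
      exact h1.congr fun t => hgf _ fun h => hint t (hball h).1

/-! ### Normal coordinates and a tube about the curve -/

open scoped ComplexConjugate

/-- The point with normal coordinates `(t, s)`. -/
noncomputable def normalPoint (γ : ℝ → ℂ) (t s : ℝ) : ℂ :=
  γ t + (s : ℂ) * (Complex.I * deriv γ t)

theorem exists_mul_abs_le {s ε : ℝ} (hs : s ≠ 0) (hε : 0 < ε) :
    ∃ x ∈ Set.Ioc (0 : ℝ) 1, |x * s| ≤ ε := by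
  have h0 : 0 < |s| := abs_pos.2 hs
  refine ⟨min 1 (ε / |s|), ⟨lt_min one_pos (by positivity), min_le_left _ _⟩, ?_⟩
  rw [abs_mul, abs_of_pos (lt_min one_pos (by positivity))]
  calc min 1 (ε / |s|) * |s| ≤ ε / |s| * |s| := by gcongr; exact min_le_right _ _
    _ = ε := by field_simp

theorem log_sub_of_slitPlane {Λ h : ℝ → ℂ} {a b : ℝ} (hab : a ≤ b) (hΛ : Continuous Λ)
    (hh : Continuous h) (he : ∀ t, h t = Complex.exp (Λ t))
    (hs : ∀ t ∈ Set.Icc a b, h t ∈ Complex.slitPlane) :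
    Λ b - Λ a = Complex.log (h b) - Complex.log (h a) := by
  have := eq_of_exp_eq_one (s := Set.Icc a b) isPreconnected_Icc
    (g := fun t => Λ t - Complex.log (h t))
    (hΛ.continuousOn.sub (hh.continuousOn.clog hs))
    (fun x hx => by
      rw [Complex.exp_sub, ← he, Complex.exp_log (Complex.slitPlane_ne_zero (hs x hx)), div_self]
      exact Complex.slitPlane_ne_zero (hs x hx))
    (x := b) (y := a) ⟨hab, le_rfl⟩ ⟨le_rfl, hab⟩
  linear_combination this

/-- A periodic function that crosses the negative real axis downwards, and otherwise stays in the
slit plane, has rotation number one. -/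
theorem PeriodicRot.one_of_crossing {f : ℝ → ℂ} {L a b : ℝ} (hf : Continuous f)
    (hp : Function.Periodic f L) (h0 : ∀ t, f t ≠ 0) (hab : a ≤ b) (hbL : b ≤ a + L)
    (h1 : ∀ t ∈ Set.Icc a b, -f t ∈ Complex.slitPlane)
    (h2 : ∀ t ∈ Set.Icc b (a + L), f t ∈ Complex.slitPlane)
    (ha : 0 < (f a).im) (hb : (f b).im < 0) : PeriodicRot f L 1 := by
  obtain ⟨Λ, hΛ, h⟩ := exists_continuous_log hf h0
  -- On `[a, b]` the principal logarithm is applied to `-f`. Passing back to `f` gains πi at each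
  -- end of the interval, which gives the total 2πi.
  have e1 := log_sub_of_slitPlane (Λ := fun t => Λ t + Real.pi * Complex.I)
    (h := fun t => -f t) hab (by fun_prop) (by fun_prop)
    (fun t => by rw [h, Complex.exp_add, Complex.exp_pi_mul_I]; ring) h1
  have e2 := log_sub_of_slitPlane hbL hΛ hf h h2
  have l1 : Complex.log (-f b) = Complex.log (f b) + Real.pi * Complex.I := by
    rw [Complex.log, Complex.log, norm_neg, Complex.arg_neg_eq_arg_add_pi_of_im_neg hb]
    push_cast; ring
  have l2 : Complex.log (-f a) = Complex.log (f a) - Real.pi * Complex.I := by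
    rw [Complex.log, Complex.log, norm_neg, Complex.arg_neg_eq_arg_sub_pi_of_im_pos ha]
    push_cast; ring
  simp only [l1, l2] at e1
  rw [hp a] at e2
  refine PeriodicRot.of_log_sub hΛ h hp (a := a) ?_
  push_cast
  linear_combination e1 + e2

namespace IsBoundedBySmoothCurve

variable {D : Set ℂ} {γ : ℝ → ℂ} {L : ℝ}

theorem continuous (hD : IsBoundedBySmoothCurve D γ L) : Continuous γ := hD.contDiff.continuous

theorem differentiable (hD : IsBoundedBySmoothCurve D γ L) : Differentiable ℝ γ :=
  hD.contDiff.differentiable (by simp)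

theorem continuous_deriv (hD : IsBoundedBySmoothCurve D γ L) : Continuous (deriv γ) :=
  hD.contDiff.continuous_deriv (by simp)

theorem periodic_deriv (hD : IsBoundedBySmoothCurve D γ L) : Function.Periodic (deriv γ) L := by
  intro t
  rw [← deriv_comp_add_const]
  exact congrArg (fun g => deriv g t) (funext hD.periodic)

theorem deriv_ne_zero (hD : IsBoundedBySmoothCurve D γ L) (t : ℝ) : deriv γ t ≠ 0 := by
  rw [← norm_pos_iff, hD.norm_deriv]; exact one_pos

theorem conj_mul_deriv (hD : IsBoundedBySmoothCurve D γ L) (t : ℝ) :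
    conj (deriv γ t) * deriv γ t = 1 := by
  rw [mul_comm, Complex.mul_conj, Complex.normSq_eq_norm_sq, hD.norm_deriv]; simp

theorem continuous_normalPoint (hD : IsBoundedBySmoothCurve D γ L) :
    Continuous fun q : ℝ × ℝ => normalPoint γ q.1 q.2 := by
  have h1 := hD.continuous
  have h2 := hD.continuous_deriv
  simp only [normalPoint]
  fun_prop

theorem periodic_normalPoint (hD : IsBoundedBySmoothCurve D γ L) (s : ℝ) :
    Function.Periodic (fun t => normalPoint γ t s) L := fun t => by
  simp only [normalPoint, hD.periodic t, hD.periodic_deriv t]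

theorem ne_of_lt (hD : IsBoundedBySmoothCurve D γ L) {t u : ℝ} (h : t < u) (h' : u < t + L) :
    γ u ≠ γ t := by
  intro he
  have hmod : ∀ x, γ (toIcoMod hD.length_pos 0 x) = γ x := fun x => by
    rw [toIcoMod]; exact hD.periodic.sub_zsmul_eq _
  have hmem : ∀ x, toIcoMod hD.length_pos 0 x ∈ Set.Ico 0 L := fun x => by
    simpa using toIcoMod_mem_Ico hD.length_pos 0 x
  have := hD.injOn (hmem u) (hmem t) (by rw [hmod, hmod, he])
  rw [toIcoMod, toIcoMod, zsmul_eq_mul, zsmul_eq_mul] at this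
  set k := toIcoDiv hD.length_pos 0 u
  set l := toIcoDiv hD.length_pos 0 t
  have hL := hD.length_pos
  have h1 : u - t = ((k - l : ℤ) : ℝ) * L := by push_cast; linarith
  have h2 : (0 : ℝ) < ((k - l : ℤ) : ℝ) := by
    by_contra hc
    nlinarith
  have h3 : ((k - l : ℤ) : ℝ) < 1 := by
    by_contra hc
    nlinarith
  have h4 : 0 < k - l := by exact_mod_cast h2
  have h5 : k - l < 1 := by exact_mod_cast h3
  omega

theorem exists_tangent_uniform (hD : IsBoundedBySmoothCurve D γ L) :
    ∃ δ > 0, ∀ t u, |u - t| ≤ δ → 0 < (conj (deriv γ t) * deriv γ u).re := by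
  have hc := hD.continuous_deriv
  have hopen : IsOpen {q : ℝ × ℝ | 0 < (conj (deriv γ q.2) * deriv γ (q.2 + q.1)).re} :=
    isOpen_lt continuous_const (Complex.continuous_re.comp
      ((Complex.continuous_conj.comp (by fun_prop)).mul (by fun_prop)))
  have hev : ∀ᶠ h in nhds (0 : ℝ), ∀ t ∈ Set.Icc 0 L,
      0 < (conj (deriv γ t) * deriv γ (t + h)).re := by
    refine isCompact_Icc.eventually_forall_of_forall_eventually fun t _ => ?_
    refine hopen.mem_nhds ?_
    change 0 < (conj (deriv γ t) * deriv γ (t + 0)).re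
    rw [add_zero, hD.conj_mul_deriv]; simp
  obtain ⟨δ, hδ, hb⟩ := Metric.nhds_basis_closedBall.eventually_iff.1 hev
  refine ⟨δ, hδ, fun t u htu => ?_⟩
  have hper : Function.Periodic (fun x => (conj (deriv γ x) * deriv γ (x + (u - t))).re) L :=
    fun x => by
      simp only [hD.periodic_deriv x, show x + L + (u - t) = x + (u - t) + L by ring,
        hD.periodic_deriv (x + (u - t))]
  obtain ⟨s, hs, hst⟩ := hper.exists_mem_Ico₀ hD.length_pos t
  have := hb (x := u - t) (by simpa using htu) s (Set.Ico_subset_Icc_self hs)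
  rw [← hst] at this
  simpa using this

/-- Two regimes. For nearby parameters the tangential coordinate is strictly monotone, because the
tangent turns by less than a right angle. For the others, compactness and injectivity bound the
distance from below. -/
theorem exists_tube_data (hD : IsBoundedBySmoothCurve D γ L) :
    ∃ δ > 0, 2 * δ < L ∧ (∀ t u, u ≠ t → |u - t| ≤ δ →
      0 < (u - t) * (conj (deriv γ t) * (γ u - γ t)).re) ∧
      ∃ ε > 0, ∀ t u, δ ≤ u - t → u - t ≤ L - δ → ε < ‖γ u - γ t‖ := by
  have hL := hD.length_pos
  obtain ⟨δ₀, hδ₀, hT⟩ := hD.exists_tangent_uniform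
  have hδ : 0 < min δ₀ (L / 4) := lt_min hδ₀ (by positivity)
  have hδL : min δ₀ (L / 4) ≤ L / 4 := min_le_right _ _
  have hδδ : min δ₀ (L / 4) ≤ δ₀ := min_le_left _ _
  generalize min δ₀ (L / 4) = δ at *
  refine ⟨δ, hδ, by linarith, fun t u hut hle => ?_, ?_⟩
  · let x : ℝ → ℝ := fun u => (conj (deriv γ t) * (γ u - γ t)).re
    have hx : ∀ u, HasDerivAt x (conj (deriv γ t) * deriv γ u).re u := fun u => by
      have h1 := ((hD.differentiable u).hasDerivAt.sub_const (γ t)).const_mul (conj (deriv γ t))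
      exact Complex.reCLM.hasFDerivAt.comp_hasDerivAt u h1
    have hmono : StrictMonoOn x (Set.Icc (t - δ) (t + δ)) := by
      refine strictMonoOn_of_deriv_pos (convex_Icc _ _)
        (fun u _ => (hx u).continuousAt.continuousWithinAt) fun u hu => ?_
      rw [interior_Icc] at hu
      rw [(hx u).deriv]
      exact hT t u (abs_le.2 ⟨by linarith [hu.1], by linarith [hu.2]⟩)
    have hxt : x t = 0 := by simp [x]
    have hmt : t ∈ Set.Icc (t - δ) (t + δ) := ⟨by linarith, by linarith⟩
    rw [abs_le] at hle
    have hmu : u ∈ Set.Icc (t - δ) (t + δ) := ⟨by linarith [hle.1], by linarith [hle.2]⟩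
    change 0 < (u - t) * x u
    rcases lt_or_gt_of_ne hut with h | h
    · have := hmono hmu hmt h
      nlinarith
    · have := hmono hmt hmu h
      nlinarith
  · have hc := hD.continuous
    obtain ⟨a, ha, hmin⟩ := (isCompact_Icc (a := (0 : ℝ)) (b := L)).prod
      (isCompact_Icc (a := δ) (b := L - δ)) |>.exists_forall_le' (a := 0)
      (f := fun q : ℝ × ℝ => ‖γ (q.1 + q.2) - γ q.1‖) (by fun_prop) (by
        rintro ⟨t, v⟩ ⟨-, hv⟩
        rw [norm_pos_iff, sub_ne_zero]
        exact hD.ne_of_lt (by linarith [hv.1]) (by linarith [hv.2]))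
    refine ⟨a / 2, by positivity, fun t u h1 h2 => ?_⟩
    have hper : Function.Periodic (fun x => ‖γ (x + (u - t)) - γ x‖) L := fun x => by
      simp only [hD.periodic x, show x + L + (u - t) = x + (u - t) + L by ring,
        hD.periodic (x + (u - t))]
    obtain ⟨s, hs, hst⟩ := hper.exists_mem_Ico₀ hL t
    have := hmin (s, u - t) ⟨Set.Ico_subset_Icc_self hs, ⟨h1, h2⟩⟩
    simp only at this
    rw [← hst] at this
    simp only [add_sub_cancel] at this
    linarith

/-- In a thin tube about the curve the normal coordinates avoid the curve, and the winding number
of the curve jumps by one across it. -/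
theorem exists_tube (hD : IsBoundedBySmoothCurve D γ L) :
    ∃ ε > 0, (∀ t s, s ≠ 0 → |s| ≤ ε → normalPoint γ t s ∉ Set.range γ) ∧
      ∀ t s, 0 < s → s ≤ ε →
        PeriodicRot (fun u => (γ u - normalPoint γ t s) / (γ u - normalPoint γ t (-s))) L 1 := by
  have hL := hD.length_pos
  obtain ⟨δ, hδ, hδL, h1, ε, hε, h2⟩ := hD.exists_tube_data
  have hmem : ∀ t s, s ≠ 0 → |s| ≤ ε → normalPoint γ t s ∉ Set.range γ := by
    rintro t s hs hsε ⟨u', hu'⟩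
    obtain ⟨u, hu, huu'⟩ := hD.periodic.exists_mem_Ico hL u' (t - δ)
    rw [huu'] at hu'
    -- The chord would be normal to the curve at `t`, with length `|s|`. For `u` near `t` its
    -- tangential part is nonzero unless `u = t`; for the other `u` its length exceeds `ε`.
    have hdiff : γ u - γ t = s * (Complex.I * deriv γ t) := by
      rw [hu', normalPoint]; ring
    by_cases hut : |u - t| ≤ δ
    · by_cases h : u = t
      · subst h
        rw [sub_self, eq_comm] at hdiff
        simp [hs, hD.deriv_ne_zero] at hdiff
      · have := h1 t u h hut
        rw [hdiff, show conj (deriv γ t) * (s * (Complex.I * deriv γ t)) =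
          s * Complex.I * (conj (deriv γ t) * deriv γ t) by ring, hD.conj_mul_deriv] at this
        simp at this
    · have h3 : δ ≤ u - t := by
        by_contra h
        exact hut (abs_le.2 ⟨by linarith [hu.1], by linarith⟩)
      have := h2 t u h3 (by linarith [hu.2])
      rw [hdiff] at this
      simp only [norm_mul, Complex.norm_real, Complex.norm_I, hD.norm_deriv, Real.norm_eq_abs] at this
      linarith
  refine ⟨ε, hε, hmem, fun t s hs hsε => ?_⟩
  have hne : ∀ u, γ u - normalPoint γ t s ≠ 0 := fun u h =>
    hmem t s hs.ne' (by rwa [abs_of_pos hs]) ⟨u, sub_eq_zero.1 h⟩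
  have hne' : ∀ u, γ u - normalPoint γ t (-s) ≠ 0 := fun u h =>
    hmem t (-s) (by linarith) (by rwa [abs_neg, abs_of_pos hs]) ⟨u, sub_eq_zero.1 h⟩
  let x : ℝ → ℝ := fun u => (conj (deriv γ t) * (γ u - γ t)).re
  let q : ℝ → ℝ := fun u => Complex.normSq (γ u - normalPoint γ t (-s))
  have hq : ∀ u, 0 < q u := fun u => Complex.normSq_pos.2 (hne' u)
  let f : ℝ → ℂ := fun u => (γ u - normalPoint γ t s) / (γ u - normalPoint γ t (-s))
  -- Multiplying numerator and denominator by the conjugate of the denominator separates real and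
  -- imaginary parts. The imaginary part has the sign of `-x u`, so near `t` the real axis is met
  -- only at `u = t`, where the real part is negative; far from `t` the real part is positive.
  have hform : ∀ u, f u = (((‖γ u - γ t‖ ^ 2 - s ^ 2 : ℝ) : ℂ) -
      ((2 * s * x u : ℝ) : ℂ) * Complex.I) / (q u : ℝ) := by
    intro u
    have hqc : ((q u : ℝ) : ℂ) ≠ 0 := by exact_mod_cast (hq u).ne'
    rw [div_eq_div_iff (hne' u) hqc]
    simp only [q, x]
    rw [← Complex.mul_conj, ← Complex.normSq_eq_norm_sq]
    push_cast
    rw [← Complex.mul_conj, Complex.re_eq_add_conj]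
    simp only [normalPoint, map_sub, map_add, map_mul, Complex.conj_I, Complex.conj_ofReal,
      Complex.conj_conj]
    have := hD.conj_mul_deriv t
    push_cast
    generalize conj (deriv γ t) = T' at *
    generalize deriv γ t = T at *
    have hI := Complex.I_sq
    linear_combination (γ u - (γ t + -s * (Complex.I * T))) * s ^ 2 * Complex.I ^ 2 * this +
      (γ u - (γ t + -s * (Complex.I * T))) * s ^ 2 * hI
  have hre : ∀ u, (f u).re = (‖γ u - γ t‖ ^ 2 - s ^ 2) / q u := fun u => by
    
    rw [hform, Complex.div_ofReal_re, Complex.sub_re, Complex.mul_re]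
    simp only [Complex.ofReal_re, Complex.ofReal_im, Complex.I_re, Complex.I_im]
    ring
  have him : ∀ u, (f u).im = -(2 * s * x u) / q u := fun u => by
    
    rw [hform, Complex.div_ofReal_im, Complex.sub_im, Complex.mul_im]
    simp only [Complex.ofReal_re, Complex.ofReal_im, Complex.I_re, Complex.I_im]
    ring
  have hcγ := hD.continuous
  have hfc : Continuous f := Continuous.div (by fun_prop) (by fun_prop) hne'
  have hx : ∀ u, u ≠ t → |u - t| ≤ δ → 0 < (u - t) * x u := h1 t
  refine PeriodicRot.one_of_crossing (f := f) (a := t - δ) (b := t + δ) hfc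
    (fun u => by simp only [f, hD.periodic u]) (fun u => div_ne_zero (hne u) (hne' u))
    (by linarith) (by linarith) ?_ ?_ ?_ ?_
  · intro u hu
    rw [Complex.mem_slitPlane_iff]
    by_cases hut : u = t
    · left
      rw [Complex.neg_re, hre, hut, sub_self]
      have := hq t
      simp only [norm_zero]
      rw [← neg_div]
      apply div_pos _ this
      nlinarith
    · right
      have := hx u hut (abs_le.2 ⟨by linarith [hu.1], by linarith [hu.2]⟩)
      have hxu : x u ≠ 0 := by rintro h; rw [h, mul_zero] at this; exact lt_irrefl _ this
      rw [Complex.neg_im, him]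
      exact neg_ne_zero.2 (div_ne_zero (neg_ne_zero.2
        (mul_ne_zero (mul_ne_zero two_ne_zero hs.ne') hxu)) (hq u).ne')
  · intro u hu
    rw [Complex.mem_slitPlane_iff]
    left
    rw [hre]
    have := h2 t u (by linarith [hu.1]) (by linarith [hu.2])
    apply div_pos _ (hq u)
    nlinarith
  · rw [him]
    have := hx (t - δ) (by linarith) (by rw [abs_le]; constructor <;> linarith)
    apply div_pos _ (hq _)
    have : x (t - δ) < 0 := by nlinarith
    nlinarith
  · rw [him]
    have := hx (t + δ) (by linarith) (by rw [abs_le]; constructor <;> linarith)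
    apply div_neg_of_neg_of_pos _ (hq _)
    have : 0 < x (t + δ) := by nlinarith
    nlinarith

/-! ### The two sides of the curve -/

/-- Off the curve the plane is the disjoint union of two open sets, the interior and the complement
of `D`; a connected set lies in one of them. -/
theorem subset_interior_of_disjoint_frontier (hD : IsBoundedBySmoothCurve D γ L) {S : Set ℂ}
    (hS : IsPreconnected S) (hdisj : ∀ z ∈ S, z ∉ Set.range γ) {a : ℂ} (ha : a ∈ S)
    (haD : a ∈ interior D) : S ⊆ interior D := by
  refine hS.subset_left_of_subset_union isOpen_interior hD.isCompact.isClosed.isOpen_compl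
    (Set.disjoint_left.2 fun z hz hz' => hz' (interior_subset hz)) (fun z hz => ?_) ⟨a, ha, haD⟩
  by_cases hzD : z ∈ D
  · left
    by_contra hzi
    exact hdisj z hz (hD.frontier_eq ▸ ⟨subset_closure hzD, hzi⟩)
  · exact Or.inr hzD

theorem forall_notMem_of_disjoint_frontier (hD : IsBoundedBySmoothCurve D γ L) {S : Set ℂ}
    (hS : IsPreconnected S) (hdisj : ∀ z ∈ S, z ∉ Set.range γ) {a : ℂ} (ha : a ∈ S)
    (haD : a ∉ D) : ∀ z ∈ S, z ∉ D := by
  intro z hz hzD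
  refine haD (interior_subset (hD.subset_interior_of_disjoint_frontier hS hdisj hz ?_ ha))
  by_contra hzi
  exact hdisj z hz (hD.frontier_eq ▸ ⟨subset_closure hzD, hzi⟩)

theorem mem (hD : IsBoundedBySmoothCurve D γ L) (t : ℝ) : γ t ∈ D :=
  hD.isCompact.isClosed.frontier_subset (hD.frontier_eq ▸ Set.mem_range_self t)

theorem notMem_interior (hD : IsBoundedBySmoothCurve D γ L) (t : ℝ) : γ t ∉ interior D :=
  fun h => (hD.frontier_eq ▸ Set.mem_range_self t : γ t ∈ frontier D).2 h

/-- A point off the curve lies on the normal through a nearest point of the curve, and the normal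
segment between the two avoids the curve. -/
theorem exists_normalPoint_eq (hD : IsBoundedBySmoothCurve D γ L) {q : ℂ}
    (hq : q ∉ Set.range γ) :
    ∃ t s, s ≠ 0 ∧ q = normalPoint γ t s ∧
      ∀ x ∈ Set.Ioc (0 : ℝ) 1, normalPoint γ t (x * s) ∉ Set.range γ := by
  have hc := hD.continuous
  obtain ⟨t, -, ht⟩ := (isCompact_Icc (a := (0 : ℝ)) (b := L)).exists_isMinOn
    ⟨0, le_rfl, hD.length_pos.le⟩ (f := fun u => ‖γ u - q‖) (by fun_prop)
  have hmin : ∀ u, ‖γ t - q‖ ≤ ‖γ u - q‖ := fun u => by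
    obtain ⟨v, hv, huv⟩ := hD.periodic.exists_mem_Ico₀ hD.length_pos u
    rw [huv]
    exact ht (Set.Ico_subset_Icc_self hv)
  -- First-order condition for the squared distance at a nearest point `γ t`.
  have horth : (conj (deriv γ t) * (q - γ t)).re = 0 := by
    have h1 := ((hD.differentiable t).hasDerivAt.sub_const q).norm_sq
    have h2 : IsLocalMin (fun u => ‖γ u - q‖ ^ 2) t :=
      Filter.Eventually.of_forall fun u => pow_le_pow_left₀ (norm_nonneg _) (hmin u) 2
    have h3 := h2.hasDerivAt_eq_zero h1
    rw [Complex.inner] at h3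
    simp only [Complex.mul_re, Complex.conj_re, Complex.conj_im, Complex.sub_re,
      Complex.sub_im] at h3 ⊢
    linarith
  have hT := hD.conj_mul_deriv t
  have hqs : q = normalPoint γ t (conj (deriv γ t) * (q - γ t)).im := by
    have h1 := Complex.re_add_im (conj (deriv γ t) * (q - γ t))
    rw [horth] at h1
    rw [normalPoint]
    push_cast at h1
    linear_combination (-(q - γ t)) * hT - deriv γ t * h1
  refine ⟨t, _, fun h => hq ⟨t, ?_⟩, hqs, fun x hx => ?_⟩
  · rw [hqs, h, normalPoint]; simp
  · rintro ⟨u, hu⟩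
    generalize (conj (deriv γ t) * (q - γ t)).im = s at *
    have hne : 0 < ‖γ t - q‖ := norm_pos_iff.2 (sub_ne_zero.2 fun h => hq ⟨t, h⟩)
    have h1 := hmin u
    rw [hu] at h1
    -- A curve point on the segment would be closer to `q` than the nearest point, by the factor `1
    -- - x`.
    have e1 : normalPoint γ t (x * s) - q = (1 - x : ℝ) * (γ t - q) := by
      rw [hqs, normalPoint, normalPoint]; push_cast; ring
    rw [e1, norm_mul, Complex.norm_real, Real.norm_eq_abs,
      abs_of_nonneg (by linarith [hx.2])] at h1
    nlinarith [hx.1]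

theorem normalPoint_pos_mem_interior (hD : IsBoundedBySmoothCurve D γ L) {ε : ℝ}
    (hε : ∀ t s, s ≠ 0 → |s| ≤ ε → normalPoint γ t s ∉ Set.range γ) {t s : ℝ} (hs : 0 < s)
    (hsε : s ≤ ε) : normalPoint γ t s ∈ interior D := by
  have hev := (hD.inward t).and (Ioc_mem_nhdsGT hs)
  obtain ⟨s', hs', hs'2⟩ := hev.exists
  have hS : IsPreconnected ((fun x => normalPoint γ t x) '' Set.Ioc 0 s) := by
    refine isPreconnected_Ioc.image _ ?_
    simp only [normalPoint]
    fun_prop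
  refine hD.subset_interior_of_disjoint_frontier hS ?_ ⟨s', hs'2, rfl⟩ hs' ⟨s, ⟨hs, le_rfl⟩, rfl⟩
  rintro _ ⟨x, hx, rfl⟩
  exact hε t x hx.1.ne' (by rw [abs_of_pos hx.1]; exact hx.2.trans hsε)

theorem isPreconnected_normalSegment (γ : ℝ → ℂ) (t s : ℝ) :
    IsPreconnected ((fun x => normalPoint γ t (x * s)) '' Set.Ioc 0 1) := by
  refine isPreconnected_Ioc.image _ ?_
  simp only [normalPoint]
  fun_prop

/-- Since `D` is bounded, some point lies outside it. Its normal segment leads to an exterior point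
in the tube, necessarily on the negative side because the positive side is interior. The negative
half-tube is connected and misses the curve, so all of it is exterior. -/
theorem normalPoint_neg_notMem (hD : IsBoundedBySmoothCurve D γ L) {ε : ℝ}
    (hε : ∀ t s, s ≠ 0 → |s| ≤ ε → normalPoint γ t s ∉ Set.range γ) {t s : ℝ} (hs : 0 < s)
    (hsε : s ≤ ε) : normalPoint γ t (-s) ∉ D := by
  have hε0 : 0 < ε := hs.trans_le hsε
  obtain ⟨q, hq⟩ : ∃ q, q ∉ D := by
    by_contra! h
    exact NormedSpace.unbounded_univ ℝ ℂ
      ((Set.eq_univ_of_forall h) ▸ hD.isCompact.isBounded)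
  have hqr : q ∉ Set.range γ := by rintro ⟨u, rfl⟩; exact hq (hD.mem u)
  obtain ⟨t₀, s₀, hs₀, rfl, hseg⟩ := hD.exists_normalPoint_eq hqr
  have hout := hD.forall_notMem_of_disjoint_frontier (isPreconnected_normalSegment γ t₀ s₀)
    (by rintro _ ⟨x, hx, rfl⟩; exact hseg x hx)
    (a := normalPoint γ t₀ s₀) ⟨1, ⟨one_pos, le_rfl⟩, by simp⟩ hq
  obtain ⟨x, hx, hxε⟩ := exists_mul_abs_le hs₀ hε0
  have hxout := hout _ ⟨x, hx, rfl⟩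
  have hneg : s₀ < 0 := by
    by_contra hpos
    have hs₀ : 0 < s₀ := lt_of_le_of_ne (not_lt.1 hpos) hs₀.symm
    have hp : 0 < x * s₀ := mul_pos hx.1 hs₀
    exact hxout (interior_subset (hD.normalPoint_pos_mem_interior hε hp
      (by rwa [abs_of_pos hp] at hxε)))
  have hS : IsPreconnected ((fun q : ℝ × ℝ => normalPoint γ q.1 (-q.2)) ''
      (Set.univ ×ˢ Set.Ioc 0 ε)) := by
    refine (isPreconnected_univ.prod isPreconnected_Ioc).image _ (Continuous.continuousOn ?_)
    exact hD.continuous_normalPoint.comp (f := fun q : ℝ × ℝ => (q.1, -q.2)) (by fun_prop)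
  have hneg' : x * s₀ < 0 := mul_neg_of_pos_of_neg hx.1 hneg
  rw [abs_of_neg hneg'] at hxε
  refine hD.forall_notMem_of_disjoint_frontier hS ?_ (a := normalPoint γ t₀ (x * s₀))
    ⟨(t₀, -(x * s₀)), ⟨Set.mem_univ _, by linarith, hxε⟩, by simp⟩ hxout _
    ⟨(t, s), ⟨Set.mem_univ _, hs, hsε⟩, rfl⟩
  rintro _ ⟨⟨t', s'⟩, ⟨-, h1⟩, rfl⟩
  exact hε t' _ (neg_ne_zero.2 h1.1.ne') (by rw [abs_neg, abs_of_pos h1.1]; exact h1.2)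

/-! ### Winding numbers and the Umlaufsatz -/

theorem periodicRot_sub_of_notMem (hD : IsBoundedBySmoothCurve D γ L) {q : ℂ} (hq : q ∉ D) :
    PeriodicRot (fun t => γ t - q) L 0 :=
  periodicRot_comp_zero_of_isSimplyConnected hD.isSimplyConnected hD.length_pos hD.continuous
    hD.periodic hD.mem (W := fun z => z - q) (by fun_prop)
    fun z hz h => hq (sub_eq_zero.1 h ▸ hz)

theorem periodicRot_sub_of_isPreconnected (hD : IsBoundedBySmoothCurve D γ L) {S : Set ℂ}
    (hS : IsPreconnected S) (hdisj : ∀ z ∈ S, z ∉ Set.range γ) {a b : ℂ} (ha : a ∈ S) (hb : b ∈ S)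
    {m : ℤ} (h : PeriodicRot (fun t => γ t - a) L m) : PeriodicRot (fun t => γ t - b) L m := by
  have hc := hD.continuous
  refine PeriodicRot.homotopyOn (F := fun z t => γ t - z) hS hD.length_pos
    (Continuous.continuousOn ?_) (fun z _ t => by simp only [hD.periodic t])
    (fun z hz t h => hdisj z hz ⟨t, sub_eq_zero.1 h⟩) ha hb h
  simp only [Function.uncurry_def]
  fun_prop

/-- The curve winds once about each interior point. -/
theorem periodicRot_sub_of_mem_interior (hD : IsBoundedBySmoothCurve D γ L) {q : ℂ}
    (hq : q ∈ interior D) : PeriodicRot (fun t => γ t - q) L 1 := by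
  obtain ⟨ε, hε0, hε, hjump⟩ := hD.exists_tube
  have hqr : q ∉ Set.range γ := by rintro ⟨u, rfl⟩; exact hD.notMem_interior u hq
  obtain ⟨t, s, hs, rfl, hseg⟩ := hD.exists_normalPoint_eq hqr
  have hdisj : ∀ z ∈ (fun x => normalPoint γ t (x * s)) '' Set.Ioc 0 1, z ∉ Set.range γ := by
    rintro _ ⟨x, hx, rfl⟩; exact hseg x hx
  have h1 : normalPoint γ t s ∈ (fun x => normalPoint γ t (x * s)) '' Set.Ioc 0 1 :=
    ⟨1, ⟨one_pos, le_rfl⟩, by simp⟩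
  have hin := hD.subset_interior_of_disjoint_frontier (isPreconnected_normalSegment γ t s)
    hdisj h1 hq
  obtain ⟨x, hx, hxε⟩ := exists_mul_abs_le hs hε0
  have hpos : 0 < x * s := by
    by_contra hneg
    have hneg : x * s < 0 := lt_of_le_of_ne (not_lt.1 hneg) (mul_ne_zero hx.1.ne' hs)
    rw [abs_of_neg hneg] at hxε
    have := hD.normalPoint_neg_notMem hε (t := t) (by linarith) hxε
    rw [neg_neg] at this
    exact this (interior_subset (hin ⟨x, hx, rfl⟩))
  rw [abs_of_pos hpos] at hxε
  -- The quotient rotates once, and the curve has winding number 0 about the mirror point outside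
  -- `D`; hence it is 1 about the tube point, and the normal segment carries this to `q`.
  have h2 := (hjump t _ hpos hxε).mul
    (hD.periodicRot_sub_of_notMem (hD.normalPoint_neg_notMem hε (t := t) hpos hxε))
  refine hD.periodicRot_sub_of_isPreconnected (isPreconnected_normalSegment γ t s) hdisj
    (a := normalPoint γ t (x * s)) ⟨x, hx, rfl⟩ h1 ?_
  rw [add_zero] at h2
  refine h2.congr fun u => (div_mul_cancel₀ _ fun h => ?_).symm
  exact hD.normalPoint_neg_notMem hε hpos hxε (sub_eq_zero.1 h ▸ hD.mem u)

/-- Hopf's Umlaufsatz: the rotation number of the tangent is one. -/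
theorem periodicRot_deriv (hD : IsBoundedBySmoothCurve D γ L) : PeriodicRot (deriv γ) L 1 := by
  obtain ⟨ε, hε0, hε, -⟩ := hD.exists_tube
  have hin : ∀ t s, 0 < s → s ≤ ε → normalPoint γ t s ∈ interior D := fun t s =>
    hD.normalPoint_pos_mem_interior hε
  have hout : normalPoint γ 0 (-ε) ∉ D := hD.normalPoint_neg_notMem hε hε0 le_rfl
  have hcγ := hD.continuous
  have hcn := hD.continuous_normalPoint
  have hrot1 : PeriodicRot (fun s => γ s - normalPoint γ 0 (-ε)) L 0 :=
    hD.periodicRot_sub_of_notMem hout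
  -- Homotopy from the curve seen from an exterior point (`u = 1`) to the inner parallel curve seen
  -- from `γ 0` (`u = 0`). In between, the moving curve is interior and the base point exterior, so
  -- they never meet.
  let G : ℝ → ℝ → ℂ := fun u s => normalPoint γ s ((1 - u) * ε) - normalPoint γ 0 (-(u * ε))
  have hG : Continuous (Function.uncurry G) := by
    refine Continuous.sub ?_ ?_
    · exact hcn.comp (f := fun q : ℝ × ℝ => (q.2, (1 - q.1) * ε)) (by fun_prop)
    · exact hcn.comp (f := fun q : ℝ × ℝ => ((0 : ℝ), -(q.1 * ε))) (by fun_prop)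
  have hrot2 : PeriodicRot (G 0) L 0 := by
    refine PeriodicRot.homotopyOn (S := Set.Icc (0 : ℝ) 1) isPreconnected_Icc hD.length_pos
      hG.continuousOn (fun u _ s => ?_) (fun u hu s h => ?_) (x := 1) (by simp) (by simp)
      (hrot1.congr fun t => by simp [G, normalPoint])
    · have := hD.periodic_normalPoint ((1 - u) * ε) s
      simp only at this
      simp only [G, this]
    · rw [sub_eq_zero] at h
      rcases hu.2.lt_or_eq with h1 | h1
      · have hmem := hin s ((1 - u) * ε) (by nlinarith) (by nlinarith [hu.1])
        rw [h] at hmem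
        rcases hu.1.lt_or_eq with h2 | h2
        · exact hD.normalPoint_neg_notMem hε (t := 0) (s := u * ε) (by positivity)
            (by nlinarith) (interior_subset hmem)
        · rw [← h2] at hmem
          exact hD.notMem_interior 0 (by simpa [normalPoint] using hmem)
      · rw [h1] at h
        refine hout ?_
        rw [one_mul] at h
        rw [← h]
        simpa [normalPoint] using hD.mem s
  -- Chords with one end pushed inward. They never vanish, and on the diagonal they equal `-ε i
  -- γ'(t)`; so the rotation number of the tangent is the sum 0 + 1 of those along the axes.
  let F : ℝ → ℝ → ℂ := fun s t => γ t - normalPoint γ s ε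
  have hF : Continuous (Function.uncurry F) := by
    refine Continuous.sub (by fun_prop) ?_
    exact hcn.comp (f := fun q : ℝ × ℝ => (q.1, ε)) (by fun_prop)
  have hF1 : PeriodicRot (fun s => F s 0) L 0 := by
    have := (PeriodicRot.const (L := L) (-1) (by simp)).mul hrot2
    rw [add_zero] at this
    exact this.congr fun s => by simp [F, G, normalPoint]
  have hF2 : PeriodicRot (fun t => F 0 t) L 1 :=
    hD.periodicRot_sub_of_mem_interior (hin 0 ε hε0 le_rfl)
  have hdiag := PeriodicRot.diagonal hF hD.length_pos.le (fun s t => by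
      have := hD.periodic_normalPoint ε s
      simp only at this
      simp only [F, this]) (fun s t => by simp only [F, hD.periodic t]) hF1 hF2
    (fun s t h => hD.notMem_interior t (sub_eq_zero.1 h ▸ hin s ε hε0 le_rfl))
  have hεc : (ε : ℂ) ≠ 0 := by exact_mod_cast hε0.ne'
  have := (PeriodicRot.const (L := L) (-(ε * Complex.I))⁻¹ (by simp [hε0.ne'])).mul hdiag
  rw [zero_add, zero_add] at this
  refine this.congr fun t => ?_
  simp only [F, normalPoint]
  have := Complex.I_ne_zero
  field_simp
  ring

end IsBoundedBySmoothCurve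

/-! ### Constant-coefficient differential operators -/

/-- The first-order operator `α ∂_x + β ∂_y` with constant complex coefficients. -/
noncomputable def planeOp (α β : ℂ) (f : ℂ → ℂ) : ℂ → ℂ :=
  fun z => α * fderiv ℝ f z 1 + β * fderiv ℝ f z Complex.I

theorem cauchyRiemannOp_eq_planeOp : cauchyRiemannOp = planeOp 1 Complex.I := by
  funext f z
  simp [cauchyRiemannOp, planeOp]

section planeOp

variable {U : Set ℂ} {f g : ℂ → ℂ}

theorem fderiv_apply_eq_planeOp (f : ℂ → ℂ) (z v : ℂ) :
    fderiv ℝ f z v = planeOp v.re v.im f z := by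
  have : v = v.re • (1 : ℂ) + v.im • Complex.I := by simp [Complex.re_add_im]
  have h := congrArg (fderiv ℝ f z) this
  rwa [map_add, map_smul, map_smul, Complex.real_smul, Complex.real_smul] at h

theorem contDiffOn_fderiv_apply (hU : IsOpen U) (hf : ContDiffOn ℝ ∞ f U) (v : ℂ) :
    ContDiffOn ℝ ∞ (fun z => fderiv ℝ f z v) U :=
  (hf.fderiv_of_isOpen hU (by simp)).clm_apply contDiffOn_const

theorem ContDiffOn.planeOp (hU : IsOpen U) (hf : ContDiffOn ℝ ∞ f U) (α β : ℂ) :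
    ContDiffOn ℝ ∞ (planeOp α β f) U :=
  (contDiffOn_const.mul (contDiffOn_fderiv_apply hU hf 1)).add
    (contDiffOn_const.mul (contDiffOn_fderiv_apply hU hf Complex.I))

theorem ContDiffOn.planeOp_iterate (hU : IsOpen U) (hf : ContDiffOn ℝ ∞ f U) (α β : ℂ) (j : ℕ) :
    ContDiffOn ℝ ∞ ((_root_.planeOp α β)^[j] f) U := by
  induction j generalizing f with
  | zero => exact hf
  | succ j ih => exact ih (hf.planeOp hU α β)

theorem ContDiffOn.differentiableAt_of_isOpen (hU : IsOpen U) (hf : ContDiffOn ℝ ∞ f U) {z : ℂ}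
    (hz : z ∈ U) : DifferentiableAt ℝ f z :=
  (hf.contDiffAt (hU.mem_nhds hz)).differentiableAt (by simp)

theorem Set.EqOn.planeOp (hU : IsOpen U) (h : Set.EqOn f g U) (α β : ℂ) :
    Set.EqOn (planeOp α β f) (planeOp α β g) U := fun z hz => by
  have : f =ᶠ[nhds z] g := Filter.eventually_of_mem (hU.mem_nhds hz) h
  simp only [_root_.planeOp, this.fderiv_eq]

theorem Set.EqOn.planeOp_iterate (hU : IsOpen U) (h : Set.EqOn f g U) (α β : ℂ) (j : ℕ) :
    Set.EqOn ((_root_.planeOp α β)^[j] f) ((_root_.planeOp α β)^[j] g) U := by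
  induction j generalizing f g with
  | zero => exact h
  | succ j ih => exact ih (h.planeOp hU α β)

theorem fderiv_planeOp_apply (hU : IsOpen U) (hf : ContDiffOn ℝ ∞ f U) (α β : ℂ) {z : ℂ}
    (hz : z ∈ U) (v : ℂ) : fderiv ℝ (planeOp α β f) z v =
      α * fderiv ℝ (fderiv ℝ f) z v 1 + β * fderiv ℝ (fderiv ℝ f) z v Complex.I := by
  have h2 : DifferentiableAt ℝ (fderiv ℝ f) z :=
    ((hf.fderiv_of_isOpen hU (m := ∞) (by simp)).contDiffAt (hU.mem_nhds hz)).differentiableAt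
      (by simp)
  have h3 : ∀ w : ℂ, HasFDerivAt (fun x => fderiv ℝ f x w)
      ((fderiv ℝ (fderiv ℝ f) z).flip w) z := fun w => by
    simpa using h2.hasFDerivAt.clm_apply (hasFDerivAt_const w z)
  have h4 := ((h3 1).const_mul α).add ((h3 Complex.I).const_mul β)
  have h5 : fderiv ℝ (planeOp α β f) z = _ := h4.fderiv
  rw [h5]
  simp

theorem planeOp_comm (hU : IsOpen U) (hf : ContDiffOn ℝ ∞ f U) (α β α' β' : ℂ) :
    Set.EqOn (planeOp α β (planeOp α' β' f)) (planeOp α' β' (planeOp α β f)) U := by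
  intro z hz
  have hsymm : IsSymmSndFDerivAt ℝ f z :=
    (hf.contDiffAt (hU.mem_nhds hz)).isSymmSndFDerivAt (by
      rw [minSmoothness_of_isRCLikeNormedField]; exact WithTop.coe_le_coe.2 (le_top : (2 : ℕ∞) ≤ ⊤))
  have h := hsymm 1 Complex.I
  rw [planeOp, planeOp]
  simp only [fderiv_planeOp_apply hU hf _ _ hz]
  rw [h]
  ring

theorem planeOp_iterate_comm (hU : IsOpen U) (hf : ContDiffOn ℝ ∞ f U) (α β α' β' : ℂ) (j : ℕ) :
    Set.EqOn (planeOp α β ((planeOp α' β')^[j] f)) ((planeOp α' β')^[j] (planeOp α β f)) U := by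
  induction j generalizing f with
  | zero => exact Set.eqOn_refl _ _
  | succ j ih =>
    intro z hz
    rw [Function.iterate_succ_apply, ih (hf.planeOp hU α' β') hz, Function.iterate_succ_apply]
    exact (planeOp_comm hU hf α β α' β').planeOp_iterate hU α' β' j hz

theorem planeOp_linear (hU : IsOpen U) (hf : ContDiffOn ℝ ∞ f U) (hg : ContDiffOn ℝ ∞ g U)
    (α β c d : ℂ) : Set.EqOn (planeOp α β fun z => c * f z + d * g z)
      (fun z => c * planeOp α β f z + d * planeOp α β g z) U := by
  intro z hz
  have h1 := (hf.differentiableAt_of_isOpen hU hz).hasFDerivAt.const_mul c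
  have h2 := (hg.differentiableAt_of_isOpen hU hz).hasFDerivAt.const_mul d
  have h3 : fderiv ℝ (fun z => c * f z + d * g z) z = _ := (h1.add h2).fderiv
  simp only [planeOp, h3]
  simp
  ring

theorem planeOp_iterate_linear (hU : IsOpen U) (hf : ContDiffOn ℝ ∞ f U)
    (hg : ContDiffOn ℝ ∞ g U) (α β c d : ℂ) (j : ℕ) :
    Set.EqOn ((planeOp α β)^[j] fun z => c * f z + d * g z)
      (fun z => c * (planeOp α β)^[j] f z + d * (planeOp α β)^[j] g z) U := by
  induction j generalizing f g with
  | zero => exact Set.eqOn_refl _ _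
  | succ j ih =>
    intro z hz
    rw [Function.iterate_succ_apply,
      (planeOp_linear hU hf hg α β c d).planeOp_iterate hU α β j hz]
    exact ih (hf.planeOp hU α β) (hg.planeOp hU α β) hz

/-- Derivatives along a line are iterated constant-direction derivatives. -/
theorem iteratedDeriv_line_eq_planeOp {H : ℂ → ℝ} (hU : IsOpen U)
    (hH : ContDiffOn ℝ ∞ (fun z => (H z : ℂ)) U) (p v : ℂ) (j : ℕ) :
    ∀ s : ℝ, p + s * v ∈ U → ((iteratedDeriv j (fun s : ℝ => H (p + s * v)) s : ℝ) : ℂ) =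
      (planeOp v.re v.im)^[j] (fun z => (H z : ℂ)) (p + s * v) := by
  induction j with
  | zero => intro s _; simp
  | succ j ih =>
    intro s hs
    have hopen : IsOpen {s : ℝ | p + s * v ∈ U} := hU.preimage (by fun_prop)
    have hline : HasDerivAt (fun s : ℝ => p + s * v) v s := by
      simpa using ((Complex.ofRealCLM.hasDerivAt (x := s)).mul_const v).const_add p
    have h1 := ((hH.planeOp_iterate hU v.re v.im j).differentiableAt_of_isOpen hU hs).hasFDerivAt
    have h2 := h1.comp_hasDerivAt s hline
    rw [fderiv_apply_eq_planeOp, ← Function.iterate_succ_apply' (planeOp _ _)] at h2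
    have h3 : HasDerivAt (fun s : ℝ => ((iteratedDeriv j (fun s : ℝ => H (p + s * v)) s : ℝ) : ℂ))
        ((planeOp v.re v.im)^[j + 1] (fun z => (H z : ℂ)) (p + s * v)) s :=
      h2.congr_of_eventuallyEq (Filter.eventually_of_mem (hopen.mem_nhds hs) fun x hx => ih x hx)
    -- The chain rule lives in ℂ while `iteratedDeriv` is real: the real part gives the real
    -- derivative, and uniqueness of the derivative shows that nothing is lost.
    have h4 : HasDerivAt (iteratedDeriv j fun s : ℝ => H (p + s * v))
        ((planeOp v.re v.im)^[j + 1] (fun z => (H z : ℂ)) (p + s * v)).re s :=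
      Complex.reCLM.hasFDerivAt.comp_hasDerivAt s h3
    rw [iteratedDeriv_succ, h4.deriv]
    exact h4.ofReal_comp.unique h3

end planeOp

/-! ### Mixed derivatives and boundary values -/

/-- The mixed derivative `(∂_x + i ∂_y)^a (∂_x - i ∂_y)^b f`. -/
noncomputable def mixedOp (a b : ℕ) (f : ℂ → ℂ) : ℂ → ℂ :=
  (planeOp 1 Complex.I)^[a] ((planeOp 1 (-Complex.I))^[b] f)

section mixedOp

variable {U : Set ℂ} {f : ℂ → ℂ}

theorem ContDiffOn.mixedOp (hU : IsOpen U) (hf : ContDiffOn ℝ ∞ f U) (a b : ℕ) :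
    ContDiffOn ℝ ∞ (mixedOp a b f) U :=
  (hf.planeOp_iterate hU _ _ b).planeOp_iterate hU _ _ a

theorem mixedOp_succ_left (a b : ℕ) (f : ℂ → ℂ) :
    mixedOp (a + 1) b f = planeOp 1 Complex.I (mixedOp a b f) :=
  Function.iterate_succ_apply' _ _ _

theorem mixedOp_succ_right (hU : IsOpen U) (hf : ContDiffOn ℝ ∞ f U) (a b : ℕ) :
    Set.EqOn (planeOp 1 (-Complex.I) (mixedOp a b f)) (mixedOp a (b + 1) f) U := fun z hz => by
  rw [_root_.mixedOp, planeOp_iterate_comm hU (hf.planeOp_iterate hU _ _ b) _ _ _ _ a hz,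
    _root_.mixedOp, Function.iterate_succ_apply' _ b]

/-- The derivative in the direction `v` in terms of the two complex operators. -/
theorem planeOp_re_im_mixedOp (hU : IsOpen U) (hf : ContDiffOn ℝ ∞ f U) (a b : ℕ) (v : ℂ) :
    Set.EqOn (planeOp v.re v.im (mixedOp a b f))
      (fun z => v / 2 * mixedOp a (b + 1) f z + conj v / 2 * mixedOp (a + 1) b f z) U := by
  intro z hz
  simp only [mixedOp_succ_left, ← mixedOp_succ_right hU hf a b hz, planeOp]
  rw [Complex.re_eq_add_conj, Complex.im_eq_sub_conj]
  have := Complex.I_sq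
  field_simp
  linear_combination (v - conj v) * fderiv ℝ (mixedOp a b f) z Complex.I * this

/-- The derivative along N is N/2 times ∂_x - i∂_y plus N̄/2 times ∂_x + i∂_y. On the pattern N^a
N̄^b X each half produces a factor N N̄ = 1, so the pattern reproduces itself. For `a = b = 0` this
identifies X with the `j`-th derivative along N. -/
theorem planeOp_iterate_mixedOp_eq (hU : IsOpen U) (hf : ContDiffOn ℝ ∞ f U) {z N X : ℂ}
    (hz : z ∈ U) (hN : N * conj N = 1) (j : ℕ) :
    ∀ a b : ℕ, (∀ a' b', a' + b' = j + (a + b) → mixedOp a' b' f z = N ^ a' * conj N ^ b' * X) →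
      (planeOp N.re N.im)^[j] (mixedOp a b f) z = N ^ a * conj N ^ b * X := by
  induction j with
  | zero => exact fun a b h => h a b (by simp)
  | succ j ih =>
    intro a b h
    rw [Function.iterate_succ_apply,
      (planeOp_re_im_mixedOp hU hf a b N).planeOp_iterate hU _ _ j hz,
      planeOp_iterate_linear hU (hf.mixedOp hU _ _) (hf.mixedOp hU _ _) _ _ _ _ j hz]
    simp only
    rw [ih a (b + 1) fun a' b' h' => h a' b' (by omega),
      ih (a + 1) b fun a' b' h' => h a' b' (by omega)]
    linear_combination N ^ a * conj N ^ b * X * hN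

end mixedOp

namespace IsBoundedBySmoothCurve

variable {D : Set ℂ} {γ : ℝ → ℂ} {L : ℝ}

theorem ofReal_normalDeriv_eq {U : Set ℂ} (hU : IsOpen U) {H : ℂ → ℝ}
    (hH : ContDiffOn ℝ ∞ (fun z => (H z : ℂ)) U) {t : ℝ} (ht : γ t ∈ U) (j : ℕ) :
    (normalDeriv H γ j t : ℂ) =
      (planeOp (Complex.I * deriv γ t).re (Complex.I * deriv γ t).im)^[j]
        (fun z => (H z : ℂ)) (γ t) := by
  have := iteratedDeriv_line_eq_planeOp hU hH (γ t) (Complex.I * deriv γ t) j 0 (by simpa using ht)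
  simpa only [normalDeriv, Complex.ofReal_zero, zero_mul, add_zero] using this

theorem normal_mul_conj (hD : IsBoundedBySmoothCurve D γ L) (t : ℝ) :
    (Complex.I * deriv γ t) * conj (Complex.I * deriv γ t) = 1 := by
  rw [map_mul, Complex.conj_I]
  linear_combination -(Complex.I ^ 2) * hD.conj_mul_deriv t - Complex.I_sq

/-- If the lower normal derivatives vanish along the boundary, all derivatives of order `k` there
are determined by the `k`-th normal derivative. -/
theorem mixedOp_eq_normalDeriv (hD : IsBoundedBySmoothCurve D γ L) {U : Set ℂ} (hU : IsOpen U)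
    (hDU : D ⊆ U) {H : ℂ → ℝ} (hH : ContDiffOn ℝ ∞ (fun z => (H z : ℂ)) U) {c : ℝ}
    (hconst : ∀ t, H (γ t) = c) {n : ℕ}
    (hnormal : ∀ j : ℕ, 1 ≤ j → j < n → ∀ t : ℝ, normalDeriv H γ j t = 0) (k : ℕ) :
    k ≤ n → ∀ t a b, a + b = k → mixedOp a b (fun z => (H z : ℂ)) (γ t) =
      (Complex.I * deriv γ t) ^ a * conj (Complex.I * deriv γ t) ^ b * normalDeriv H γ k t := by
  have hmem : ∀ t, γ t ∈ U := fun t => hDU (hD.mem t)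
  induction k with
  | zero =>
    intro _ t a b hab
    obtain ⟨rfl, rfl⟩ : a = 0 ∧ b = 0 := by omega
    simp [mixedOp, normalDeriv]
  | succ k ih =>
    intro hk t
    -- Only constancy along the curve is needed. In order zero the constant is the boundary value of
    -- `H`; in the orders `1 ≤ k < n` it is 0.
    have hcon : ∀ a b, a + b = k → ∃ d : ℂ, ∀ t, mixedOp a b (fun z => (H z : ℂ)) (γ t) = d := by
      intro a b hab
      rcases Nat.eq_zero_or_pos k with rfl | hk0
      · obtain ⟨rfl, rfl⟩ : a = 0 ∧ b = 0 := by omega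
        exact ⟨c, fun t => by simp [mixedOp, hconst]⟩
      · refine ⟨0, fun t => ?_⟩
        rw [ih (by omega) t a b hab, hnormal k hk0 (by omega) t]
        simp
    have hN := hD.normal_mul_conj t
    -- The tangential derivative of a constant vanishes; multiplying by `2i` turns the tangent into
    -- the normal. This trades one ∂_x + i∂_y for one ∂_x - i∂_y.
    have htan : ∀ a b, a + b = k →
        (Complex.I * deriv γ t) * mixedOp a (b + 1) (fun z => (H z : ℂ)) (γ t) =
        conj (Complex.I * deriv γ t) * mixedOp (a + 1) b (fun z => (H z : ℂ)) (γ t) := by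
      intro a b hab
      obtain ⟨d, hd⟩ := hcon a b hab
      have h1 := ((hH.mixedOp hU a b).differentiableAt_of_isOpen hU (hmem t)).hasFDerivAt
      have h2 := h1.comp_hasDerivAt t (hD.differentiable t).hasDerivAt
      have h3 : HasDerivAt (mixedOp a b (fun z => (H z : ℂ)) ∘ γ) 0 t := by
        rw [show mixedOp a b (fun z => (H z : ℂ)) ∘ γ = fun _ => d from funext hd]
        exact hasDerivAt_const t d
      have h4 := h2.unique h3
      rw [fderiv_apply_eq_planeOp, planeOp_re_im_mixedOp hU hH a b _ (hmem t)] at h4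
      simp only [map_mul, Complex.conj_I]
      linear_combination 2 * Complex.I * h4
    have key : ∀ b a, a + b = k + 1 → mixedOp a b (fun z => (H z : ℂ)) (γ t) =
        (Complex.I * deriv γ t) ^ a * conj (Complex.I * deriv γ t) ^ b *
          (conj (Complex.I * deriv γ t) ^ (k + 1) *
            mixedOp (k + 1) 0 (fun z => (H z : ℂ)) (γ t)) := by
      intro b
      induction b with
      | zero =>
        intro a ha
        obtain rfl : a = k + 1 := by omega
        rw [pow_zero, mul_one, ← mul_assoc, ← mul_pow, hN, one_pow, one_mul]
      | succ b ihb =>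
        intro a ha
        have h1 := ihb (a + 1) (by omega)
        have h2 := htan a b (by omega)
        rw [h1] at h2
        have h3 : mixedOp a (b + 1) (fun z => (H z : ℂ)) (γ t) =
            conj (Complex.I * deriv γ t) * ((Complex.I * deriv γ t) *
              mixedOp a (b + 1) (fun z => (H z : ℂ)) (γ t)) := by
          rw [← mul_assoc, mul_comm (conj _), hN, one_mul]
        rw [h3, h2]
        linear_combination (Complex.I * deriv γ t) ^ a * conj (Complex.I * deriv γ t) ^ (b + 1) *
          (conj (Complex.I * deriv γ t) ^ (k + 1) *
            mixedOp (k + 1) 0 (fun z => (H z : ℂ)) (γ t)) * hN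
    have hX := planeOp_iterate_mixedOp_eq hU hH (hmem t) hN (k + 1) 0 0
      (fun a b hab => key b a (by omega))
    rw [pow_zero, pow_zero, one_mul, one_mul] at hX
    have hX' : (normalDeriv H γ (k + 1) t : ℂ) = _ :=
      (ofReal_normalDeriv_eq hU hH (hmem t) (k + 1)).trans hX
    intro a b hab
    rw [key b a hab, hX']

end IsBoundedBySmoothCurve

/-! ### Finiteness of the zeros and conclusion -/

/-- A function with isolated zeros on a compact set has finitely many zeros there. -/
theorem finite_zeros_of_isolated {D : Set ℂ} (hD : IsCompact D) {f : ℂ → ℂ}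
    (hf : ContinuousOn f D)
    (hiso : ∀ z ∈ D, f z = 0 → ∀ᶠ w in nhdsWithin z (D \ {z}), f w ≠ 0) :
    {z | z ∈ D ∧ f z = 0}.Finite := by
  by_contra hinf
  obtain ⟨x, hx, hacc⟩ := Set.Infinite.exists_accPt_of_subset_isCompact hinf hD fun z hz => hz.1
  have hev : ∀ᶠ w in nhdsWithin x (D \ {x}), f w ≠ 0 := by
    by_cases h : f x = 0
    · exact hiso x hx h
    · exact ((hf x hx).mono Set.sdiff_subset).eventually_ne h
  rw [accPt_iff_frequently] at hacc
  rw [eventually_nhdsWithin_iff] at hev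
  obtain ⟨y, ⟨hyx, hyD, hy0⟩, hy⟩ := (hacc.and_eventually hev).exists
  exact hy ⟨hyD, hyx⟩ hy0

theorem mainTheorem3 (n : ℕ) (D : Set ℂ) (γ : ℝ → ℂ) (L : ℝ)
    (hD : IsBoundedBySmoothCurve D γ L)
    (U : Set ℂ) (hU : IsOpen U) (hDU : D ⊆ U)
    (H : ℂ → ℝ) (hH : ContDiffOn ℝ ∞ H U)
    (hconst : ∃ c : ℝ, ∀ z ∈ frontier D, H z = c)
    (hnormal : ∀ j : ℕ, 1 ≤ j → j < n → ∀ t : ℝ, normalDeriv H γ j t = 0)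
    (hisolated : ∀ z ∈ D, loewnerField H n z = 0 →
      ∀ᶠ w in nhdsWithin z (D \ {z}), loewnerField H n w ≠ 0)
    (hboundary : ∀ z ∈ frontier D, loewnerField H n z ≠ 0) :
    (∃ Z : Finset ℂ, (Z : Set ℂ) = {z | z ∈ interior D ∧ loewnerField H n z = 0} ∧
      ∃ ind : ℂ → ℤ, (∀ z ∈ Z, HasIndexAt (loewnerField H n) z (ind z)) ∧
        ∑ z ∈ Z, ind z = (n : ℤ)) ∧
    (∀ t α : ℝ, deriv γ t = Complex.exp ((α : ℂ) * Complex.I) →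
      loewnerField H n (γ t) =
        Complex.I ^ n * (normalDeriv H γ n t : ℂ) *
          Complex.exp (Complex.I * (n : ℂ) * (α : ℂ))) ∧
    HasRotationNumber (fun t : ℝ => loewnerField H n (γ t)) 0 L (n : ℤ) := by
  have hL := hD.length_pos
  have hfr : ∀ t, γ t ∈ frontier D := fun t => hD.frontier_eq ▸ Set.mem_range_self t
  have hHc : ContDiffOn ℝ ∞ (fun z => (H z : ℂ)) U := Complex.ofRealCLM.contDiff.comp_contDiffOn hH
  have hV : loewnerField H n = mixedOp n 0 (fun z => (H z : ℂ)) := by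
    rw [loewnerField, cauchyRiemannOp_eq_planeOp]; rfl
  obtain ⟨c, hc⟩ := hconst
  have hform : ∀ t, loewnerField H n (γ t) =
      (Complex.I * deriv γ t) ^ n * normalDeriv H γ n t := fun t => by
    rw [hV, hD.mixedOp_eq_normalDeriv hU hDU hHc (fun t => hc _ (hfr t)) hnormal n le_rfl t n 0
      (by simp)]
    simp
  have hVc : ContinuousOn (loewnerField H n) D := by
    rw [hV]; exact (hHc.mixedOp hU n 0).continuousOn.mono hDU
  have hcγ : Continuous fun t => loewnerField H n (γ t) :=
    hVc.comp_continuous hD.continuous hD.mem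
  have hpγ : Function.Periodic (fun t => loewnerField H n (γ t)) L := fun t => by
    simp only [hD.periodic t]
  obtain ⟨m, hm⟩ := PeriodicRot.exists_of_continuous hcγ hpγ fun t => hboundary _ (hfr t)
  have hmn : m = n := by
    have hcd := hD.continuous_deriv
    -- Squaring removes the unknown sign of the normal derivative: the quotient of the squares is a
    -- positive real, so `2 m = 2 n`.
    have h1 := ((PeriodicRot.const (L := L) (Complex.I ^ n) (by simp)).mul
      (hD.periodicRot_deriv.pow n)).pow 2
    have h2 := h1.of_div_slitPlane (f := fun t => loewnerField H n (γ t) ^ 2) (hcγ.pow 2)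
      (fun t => by simp only [hD.periodic t]) (by fun_prop)
      (fun t => by simp only [hD.periodic_deriv t]) fun t => ?_
    · have := (hm.pow 2).unique hL.le h2
      push_cast at this
      linarith
    · have h0 := hboundary _ (hfr t)
      rw [hform] at h0 ⊢
      have hT := hD.deriv_ne_zero t
      have hν : normalDeriv H γ n t ≠ 0 := fun h => h0 (by simp [h])
      rw [show ((Complex.I * deriv γ t) ^ n * (normalDeriv H γ n t : ℂ)) ^ 2 /
        (Complex.I ^ n * deriv γ t ^ n) ^ 2 = ((normalDeriv H γ n t ^ 2 : ℝ) : ℂ) by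
          have := Complex.I_ne_zero
          push_cast
          field_simp
          ring]
      rw [Complex.ofReal_mem_slitPlane]
      positivity
  subst hmn
  refine ⟨?_, fun t α ht => ?_, hm.hasRotationNumber⟩
  · have hfin := finite_zeros_of_isolated hD.isCompact hVc hisolated
    have hset : (hfin.toFinset : Set ℂ) = {z | z ∈ interior D ∧ loewnerField H n z = 0} := by
      ext z
      rw [Set.Finite.coe_toFinset]
      refine ⟨fun ⟨hz, h0⟩ => ⟨?_, h0⟩, fun ⟨hz, h0⟩ => ⟨interior_subset hz, h0⟩⟩
      by_contra hzi
      exact hboundary z ⟨subset_closure hz, hzi⟩ h0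
    refine ⟨hfin.toFinset, hset, ?_⟩
    obtain ⟨ind, hind, hrot⟩ := exists_index_sum hD.isSimplyConnected hL hD.continuous hD.periodic
      hD.mem hD.notMem_interior (fun z => hD.periodicRot_sub_of_mem_interior) hfin.toFinset
      (loewnerField H n) (fun z hz => (hset.subset hz).1) hVc
      (fun z hz hz' h0 => hz' (by simpa using ⟨hz, h0⟩))
    exact ⟨ind, fun z hz => (hind z hz).hasIndexAt, hrot.unique hL.le hm⟩
  · rw [hform, ht, mul_pow, ← Complex.exp_nat_mul]
    rw [show Complex.I * (n : ℂ) * (α : ℂ) = n * ((α : ℂ) * Complex.I) by ring]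
    ring
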